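/- Let $R$ be an associative ring with identity, $\mathrm{Mod}R$ the category of left $R$-modules and $\mathrm{D}(R)$ its unbounded derived category. For a class $\mathsf{X}$ of $R$-modules put $$\mathcal{X}_{\mathsf P}=\{X\in \mathrm{D}(R) : \text{some semi-projective resolution } P\simeq X \text{ has } \mathrm{coker}(P^{s-1}\to P^s)\in\mathsf{X} \text{ for all } s\in\mathbb{Z}\},$$ $$\mathcal{X}_{\mathsf I}=\{Y\in \mathrm{D}(R) : \text{some semi-injective resolution } Y\simeq I \text{ has } \ker(I^{s}\to I^{s+1})\in\mathsf{X} \text{ for all } s\in\mathbb{Z}\}.$$ Let $\langle\mathsf P\rangle_1$ be the class of retracts in $\mathrm{D}(R)$ of coproducts of shifts of projective $R$-modules, and let $\xi$ be the class of exact triangles $X\to Y\to Z\to X[1]$ in $\mathrm{D}(R)$ such that $0\to\mathrm{Hom}(P,X)\to\mathrm{Hom}(P,Y)\to\mathrm{Hom}(P,Z)\to 0$ is exact for all $P\in\langle\mathsf P\rangle_1$. An object $P$ is $\xi$-projective if $\mathrm{Hom}(P,-)$ turns every triangle of $\xi$ into such a short exact sequence. A $\xi$-projective resolution of $X$ is a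 sequence $\cdots\to P_1\to P_0\to X$ spliced from triangles $K_{n+1}\to P_n\to K_n\to K_{n+1}[1]$ in $\xi$ with $P_n$ $\xi$-projective and $K_0\simeq X$, and $\xi xt^1_\xi(X,Y)$ is the first cohomology of $\mathrm{Hom}_{\mathrm{D}(R)}(P_\bullet,Y)$, that is, the first right $\xi$-derived functor of $\mathrm{Hom}_{\mathrm{D}(R)}(-,Y)$ at $X$. A pair $(\mathcal{A},\mathcal{B})$ of classes of objects of $\mathrm{D}(R)$ is a cotorsion pair with respect to $\xi$ if $\mathcal{B}=\{U : \xi xt^1_\xi(A,U)=0\ \forall A\in\mathcal{A}\}$ and $\mathcal{A}=\{V : \xi xt^1_\xi(V,B)=0\ \forall B\in\mathcal{B}\}$. It is complete if every $X$ has triangles $B\to A\to X\to B[1]$ and $X\to B'\to A'\to X[1]$ in $\xi$ with $A,A'\in\mathcal{A}$ and $B,B'\in\mathcal{B}$. It is hereditary if, for all triangles $A_1\to A_2\to A_3\to A_1[1]$ and $B_1\to B_2\to B_3\to B_1[1]$ in $\xi$, $A_2,A_3\in\mathcal{A}$ implies $A_1\in\mathcal{A}$, and $B_1,B_2\in\mathcal{B}$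 implies $B_3\in\mathcal{B}$. Complete hereditary cotorsion pairs in $\mathrm{Mod}R$ are defined in the same way, with $\mathrm{Ext}^1_R$ and short exact sequences. Let $\mathsf{A},\mathsf{B},\mathsf{C}$ be classes of $R$-modules closed under isomorphisms and direct summands. Then $(\mathsf{A},\mathsf{C})$ and $(\mathsf{C},\mathsf{B})$ are complete hereditary cotorsion pairs in $\mathrm{Mod}R$ if and only if $(\mathcal{A}_{\mathsf P},\mathcal{C}_{\mathsf I})$ and $(\mathcal{C}_{\mathsf I},\mathcal{B}_{\mathsf I})$ are complete hereditary cotorsion pairs in $\mathrm{D}(R)$ with respect to $\xi$. Moreover, in this case $\mathcal{C}_{\mathsf P}=\mathcal{C}_{\mathsf I}$. -/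

import Mathlib

open CategoryTheory Limits Pretriangulated

universe w u

noncomputable section

/-! ### Cotorsion pairs in an abelian category -/

namespace AbelianCotorsion

variable {C : Type*} [Category* C] [Abelian C] [HasExt.{w} C]

/-- `A^⊥ = {M | Ext¹(X, M) = 0 for all X ∈ A}`. -/
def rightPerp (A : ObjectProperty C) : ObjectProperty C :=
  fun M => ∀ X, A X → Subsingleton (Abelian.Ext X M 1)

/-- `^⊥B = {N | Ext¹(N, Y) = 0 for all Y ∈ B}`. -/
def leftPerp (B : ObjectProperty C) : ObjectProperty C :=
  fun N => ∀ Y, B Y → Subsingleton (Abelian.Ext N Y 1)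

/-- `(A, B)` is a complete hereditary cotorsion pair. -/
structure IsCompleteHereditary (A B : ObjectProperty C) : Prop where
  right_eq : rightPerp A = B
  left_eq : leftPerp B = A
  /-- `0 → B → A → M → 0`. -/
  exists_precover (M : C) : ∃ (Y X : C) (i : Y ⟶ X) (p : X ⟶ M) (h : i ≫ p = 0),
    B Y ∧ A X ∧ (ShortComplex.mk i p h).ShortExact
  /-- `0 → M → B' → A' → 0`. -/
  exists_preenvelope (M : C) : ∃ (Y X : C) (i : M ⟶ Y) (p : Y ⟶ X) (h : i ≫ p = 0),
    B Y ∧ A X ∧ (ShortComplex.mk i p h).ShortExact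
  /-- `A` is closed under kernels of epimorphisms. -/
  kernel_mem (S : ShortComplex C) : S.ShortExact → A S.X₂ → A S.X₃ → A S.X₁
  /-- `B` is closed under cokernels of monomorphisms. -/
  cokernel_mem (S : ShortComplex C) : S.ShortExact → B S.X₁ → B S.X₂ → B S.X₃

end AbelianCotorsion

/-! ### Homological algebra relative to a class `ξ` of triangles -/

namespace RelTriangulated

variable {T : Type*} [Category* T] [Preadditive T] [HasZeroObject T] [HasShift T ℤ]
  [∀ n : ℤ, (shiftFunctor T n).Additive] [Pretriangulated T]

/-- For a triangle `X ⟶ Y ⟶ Z ⟶ X⟦1⟧`, the sequence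
`0 → Hom(P, X) → Hom(P, Y) → Hom(P, Z) → 0` is exact. -/
structure HomShortExact (P : T) (Δ : Triangle T) : Prop where
  injective : Function.Injective (Preadditive.rightComp P Δ.mor₁)
  exact : Function.Exact (Preadditive.rightComp P Δ.mor₁) (Preadditive.rightComp P Δ.mor₂)
  surjective : Function.Surjective (Preadditive.rightComp P Δ.mor₂)

/-- The class `ξ(𝒳)` of distinguished triangles on which `Hom(P, -)` is short exact for every
`P` in `𝒳`. -/
def properClass (𝒳 : ObjectProperty T) : Set (Triangle T) :=
  {Δ | Δ ∈ distTriang T ∧ ∀ P, 𝒳 P → HomShortExact P Δ}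

/-- `ξ`-projective objects. -/
def IsProjective (ξ : Set (Triangle T)) : ObjectProperty T :=
  fun P => ∀ Δ ∈ ξ, HomShortExact P Δ

/-- A `ξ`-projective resolution `⋯ ⟶ P₂ ⟶ P₁ ⟶ P₀ ⟶ X`, spliced from triangles
`K (n + 1) ⟶ P n ⟶ K n ⟶ (K (n + 1))⟦1⟧` in `ξ` with `K 0 ≅ X`. -/
structure ProjResolution (ξ : Set (Triangle T)) (X : T) where
  K : ℕ → T
  P : ℕ → T
  i (n : ℕ) : K (n + 1) ⟶ P n
  p (n : ℕ) : P n ⟶ K n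
  δ (n : ℕ) : K n ⟶ (K (n + 1))⟦(1 : ℤ)⟧
  mem (n : ℕ) : Triangle.mk (i n) (p n) (δ n) ∈ ξ
  projective (n : ℕ) : IsProjective ξ (P n)
  iso : K 0 ≅ X

namespace ProjResolution

variable {ξ : Set (Triangle T)} {X : T} (ρ : ProjResolution ξ X)

/-- The differential `P (n + 1) ⟶ P n`. -/
def d (n : ℕ) : ρ.P (n + 1) ⟶ ρ.P n := ρ.p (n + 1) ≫ ρ.i n

/-- The `(n + 1)`-st cohomology group of the complex `Hom(P₀, Y) → Hom(P₁, Y) → ⋯`. -/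
abbrev HomCohomologySucc (Y : T) (n : ℕ) : Type _ :=
  (Preadditive.leftComp Y (ρ.d (n + 1))).ker ⧸
    (Preadditive.leftComp Y (ρ.d n)).range.addSubgroupOf
      (Preadditive.leftComp Y (ρ.d (n + 1))).ker

end ProjResolution

/-- `ξxt¹(X, Y) = 0`, where `ξxt¹(-, Y)` is the first right `ξ`-derived functor of `Hom(-, Y)`,
computed by `ξ`-projective resolutions of `X`. -/
def XiExtOneVanishes (ξ : Set (Triangle T)) (X Y : T) : Prop :=
  ∀ ρ : ProjResolution ξ X, Subsingleton (ρ.HomCohomologySucc Y 0)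

/-- `𝒜^{⊥_ξ}`. -/
def rightPerp (ξ : Set (Triangle T)) (𝒜 : ObjectProperty T) : ObjectProperty T :=
  fun U => ∀ X, 𝒜 X → XiExtOneVanishes ξ X U

/-- `^{⊥_ξ}ℬ`. -/
def leftPerp (ξ : Set (Triangle T)) (ℬ : ObjectProperty T) : ObjectProperty T :=
  fun V => ∀ Y, ℬ Y → XiExtOneVanishes ξ V Y

/-- `(𝒜, ℬ)` is a complete hereditary cotorsion pair with respect to `ξ`. -/
structure IsCompleteHereditary (ξ : Set (Triangle T)) (𝒜 ℬ : ObjectProperty T) : Prop where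
  right_eq : rightPerp ξ 𝒜 = ℬ
  left_eq : leftPerp ξ ℬ = 𝒜
  /-- `B ⟶ A ⟶ X ⟶ B⟦1⟧`. -/
  exists_precover (X : T) : ∃ (B A : T) (f : B ⟶ A) (g : A ⟶ X) (h : X ⟶ B⟦(1 : ℤ)⟧),
    ℬ B ∧ 𝒜 A ∧ Triangle.mk f g h ∈ ξ
  /-- `X ⟶ B' ⟶ A' ⟶ X⟦1⟧`. -/
  exists_preenvelope (X : T) : ∃ (B A : T) (f : X ⟶ B) (g : B ⟶ A) (h : A ⟶ X⟦(1 : ℤ)⟧),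
    ℬ B ∧ 𝒜 A ∧ Triangle.mk f g h ∈ ξ
  left_mem (Δ : Triangle T) : Δ ∈ ξ → 𝒜 Δ.obj₂ → 𝒜 Δ.obj₃ → 𝒜 Δ.obj₁
  right_mem (Δ : Triangle T) : Δ ∈ ξ → ℬ Δ.obj₁ → ℬ Δ.obj₂ → ℬ Δ.obj₃

end RelTriangulated

/-! ### The derived category of `R`-modules -/

namespace DerivedMod

variable {R : Type u} [Ring R]

/-- Semi-projective (dg-projective) complexes: all terms are projective, and every map to an
acyclic complex is null-homotopic. -/
structure IsSemiProjective (P : CochainComplex (ModuleCat.{u} R) ℤ) : Prop where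
  projective (s : ℤ) : Projective (P.X s)
  isKProjective : P.IsKProjective

/-- Semi-injective (dg-injective) complexes: all terms are injective, and every map from an
acyclic complex is null-homotopic. -/
structure IsSemiInjective (I : CochainComplex (ModuleCat.{u} R) ℤ) : Prop where
  injective (s : ℤ) : Injective (I.X s)
  isKInjective : I.IsKInjective

variable [HasDerivedCategory.{w} (ModuleCat.{u} R)]

/-- `𝒳_P`: the objects `X` of `D(R)` with a semi-projective resolution `P ≃ X` such that
`coker(P^{s-1} ⟶ P^s)` lies in `S` for all `s`. -/
def projLift (S : ObjectProperty (ModuleCat.{u} R)) :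
    ObjectProperty (DerivedCategory (ModuleCat.{u} R)) :=
  fun X => ∃ P : CochainComplex (ModuleCat.{u} R) ℤ, IsSemiProjective P ∧
    Nonempty (DerivedCategory.Q.obj P ≅ X) ∧ ∀ s : ℤ, S (cokernel (P.d (s - 1) s))

/-- `𝒳_I`: the objects `Y` of `D(R)` with a semi-injective resolution `Y ≃ I` such that
`ker(I^s ⟶ I^{s+1})` lies in `S` for all `s`. -/
def injLift (S : ObjectProperty (ModuleCat.{u} R)) :
    ObjectProperty (DerivedCategory (ModuleCat.{u} R)) :=
  fun Y => ∃ I : CochainComplex (ModuleCat.{u} R) ℤ, IsSemiInjective I ∧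
    Nonempty (Y ≅ DerivedCategory.Q.obj I) ∧ ∀ s : ℤ, S (kernel (I.d s (s + 1)))

/-- `⟨S⟩₁`: retracts in `D(R)` of coproducts of shifts of modules in `S`. -/
def angleOne (S : ObjectProperty (ModuleCat.{u} R)) :
    ObjectProperty (DerivedCategory (ModuleCat.{u} R)) :=
  fun X => ∃ (ι : Type u) (M : ι → ModuleCat.{u} R) (n : ι → ℤ)
    (c : Cofan fun j => ((DerivedCategory.singleFunctor (ModuleCat.{u} R) 0).obj (M j))⟦n j⟧),
    (∀ j, S (M j)) ∧ Nonempty (IsColimit c) ∧ Nonempty (Retract X c.pt)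

variable (R) in
/-- The class `ξ = ξ(⟨P⟩₁)` of cohomologically ghost triangles in `D(R)`, where `P` is the class
of projective modules. -/
def xi : Set (Triangle (DerivedCategory (ModuleCat.{u} R))) :=
  RelTriangulated.properClass (angleOne fun M : ModuleCat.{u} R => Projective M)

end DerivedMod

end

noncomputable section

/-!
A distinguished triangle lies in `ξ` exactly when it induces short exact sequences in cohomology,
and the `ξ`-projective objects are the coproducts of shifted projective modules. Hence a
`ξ`-projective resolution of `X` is a projective resolution of `Hˢ(X)` in each degree `s`, and
`ξxt¹(X, Y) = 0` means that `Ext¹(Hˢ(X), Hˢ(Y)) = 0` for all `s`. Cotorsion pairs with respect to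
`ξ` are therefore detected in cohomology: `(A, B)` is a complete hereditary cotorsion pair if and
only if the classes `cohLift A` and `cohLift B` of objects with cohomology in `A` and in `B` form
one. The approximation triangles of `X` come from special approximations of the terms of
`0 → Bˢ → Zˢ → Hˢ → 0` and `0 → Zˢ → Kˢ → Bˢ⁺¹ → 0`, for a complex `K` representing `X`, glued by
the horseshoe lemma.

It remains to compare `𝒳_P` and `𝒳_I` with the cohomological lifts. Let `P` be a semi-projective
complex with cohomology in `A`, where `(A, B)` is a complete hereditary cotorsion pair. A map from
`P` to a complex with cohomology in `B` which vanishes in cohomology is null-homotopic, because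
`Ext¹(Hˢ, Hˢ⁻¹) = 0`; applied to stalk complexes this shows that the cokernels of the
differentials of `P` are in `A`. Conversely, if `(𝒜_P, ℬ)` is a complete hereditary cotorsion pair
with respect to `ξ`, then `𝒜_P` is determined by its stalk complexes, and two-term complexes of
projective modules show that their modules are precisely those of `A`. The injective case is dual.

A semi-injective resolution of `K` is the cone of a map `L ⟶ K`, where `L` is the homotopy limit of
a tower over `K` whose maps have semi-injective cones and vanish in cohomology; the latter makes `L`
acyclic. Semi-projective resolutions are obtained by passing to the opposite category.
-/

/-! ### Cotorsion pairs and the vanishing of `Ext¹` -/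

namespace AbelianCotorsion

open Abelian

variable {C : Type*} [Category* C] [Abelian C] [HasExt.{w} C]

theorem subsingleton_ext_of_iso {X X' Y Y' : C} (e : X ≅ X') (f : Y ≅ Y')
    [h : Subsingleton (Ext X Y 1)] : Subsingleton (Ext X' Y' 1) := by
  refine subsingleton_of_forall_eq 0 fun x => ?_
  have h1 : (Ext.mk₀ e.inv).comp (((Ext.mk₀ e.hom).comp (x.comp (Ext.mk₀ f.inv) (add_zero 1))
      (zero_add 1)).comp (Ext.mk₀ f.hom) (add_zero 1)) (zero_add 1) = x := by
    simp [Ext.comp_assoc_of_second_deg_zero, Ext.comp_assoc_of_third_deg_zero]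
  rw [← h1, Subsingleton.elim ((Ext.mk₀ e.hom).comp (x.comp (Ext.mk₀ f.inv) (add_zero 1))
    (zero_add 1)) 0]
  simp

theorem exists_lift_of_subsingleton_ext {S : ShortComplex C} (hS : S.ShortExact) {X : C}
    [Subsingleton (Ext X S.X₁ 1)] (φ : X ⟶ S.X₃) : ∃ ψ : X ⟶ S.X₂, ψ ≫ S.g = φ := by
  obtain ⟨x, hx⟩ := Ext.covariant_sequence_exact₃ X hS (Ext.mk₀ φ) (zero_add 1)
    (Subsingleton.elim _ _)
  obtain ⟨ψ, rfl⟩ := Ext.homEquiv₀.symm.surjective x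
  refine ⟨ψ, Ext.homEquiv₀.symm.injective ?_⟩
  simpa using hx

theorem exists_extension_of_subsingleton_ext {S : ShortComplex C} (hS : S.ShortExact) {Y : C}
    [Subsingleton (Ext S.X₃ Y 1)] (φ : S.X₁ ⟶ Y) : ∃ ψ : S.X₂ ⟶ Y, S.f ≫ ψ = φ := by
  obtain ⟨x, hx⟩ := Ext.contravariant_sequence_exact₁ hS Y (Ext.mk₀ φ) (add_zero 1)
    (Subsingleton.elim _ _)
  obtain ⟨ψ, rfl⟩ := Ext.homEquiv₀.symm.surjective x
  refine ⟨ψ, Ext.homEquiv₀.symm.injective ?_⟩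
  simpa using hx

theorem subsingleton_ext_of_exists_lift {S : ShortComplex C} (hS : S.ShortExact) {X : C}
    [Subsingleton (Ext X S.X₂ 1)] (h : ∀ φ : X ⟶ S.X₃, ∃ ψ : X ⟶ S.X₂, ψ ≫ S.g = φ) :
    Subsingleton (Ext X S.X₁ 1) := by
  refine subsingleton_of_forall_eq 0 fun x => ?_
  obtain ⟨y, rfl⟩ := Ext.covariant_sequence_exact₁ X hS x (Subsingleton.elim _ _) (zero_add 1)
  obtain ⟨φ, rfl⟩ := Ext.homEquiv₀.symm.surjective y
  obtain ⟨ψ, rfl⟩ := h φ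
  have : (Ext.mk₀ (ψ ≫ S.g)) = (Ext.mk₀ ψ).comp (Ext.mk₀ S.g) (add_zero 0) := by simp
  change (Ext.mk₀ (ψ ≫ S.g)).comp _ _ = 0
  rw [this, Ext.comp_assoc_of_second_deg_zero]
  simp

theorem subsingleton_ext_of_exists_extension {S : ShortComplex C} (hS : S.ShortExact) {Y : C}
    [Subsingleton (Ext S.X₂ Y 1)] (h : ∀ φ : S.X₁ ⟶ Y, ∃ ψ : S.X₂ ⟶ Y, S.f ≫ ψ = φ) :
    Subsingleton (Ext S.X₃ Y 1) := by
  refine subsingleton_of_forall_eq 0 fun x => ?_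
  obtain ⟨y, rfl⟩ := Ext.contravariant_sequence_exact₃ hS Y x (Subsingleton.elim _ _) (add_zero 1)
  obtain ⟨φ, rfl⟩ := Ext.homEquiv₀.symm.surjective y
  obtain ⟨ψ, rfl⟩ := h φ
  change hS.extClass.comp (Ext.mk₀ (S.f ≫ ψ)) _ = 0
  rw [← Ext.mk₀_comp_mk₀, ← Ext.comp_assoc_of_second_deg_zero]
  simp

theorem subsingleton_ext_right_of_shortExact {S : ShortComplex C} (hS : S.ShortExact) {X : C}
    [Subsingleton (Ext X S.X₁ 1)] [Subsingleton (Ext X S.X₃ 1)] :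
    Subsingleton (Ext X S.X₂ 1) := by
  refine subsingleton_of_forall_eq 0 fun x => ?_
  obtain ⟨y, rfl⟩ := Ext.covariant_sequence_exact₂ X hS x (Subsingleton.elim _ _)
  rw [Subsingleton.elim y 0, Ext.zero_comp]

theorem subsingleton_ext_left_of_shortExact {S : ShortComplex C} (hS : S.ShortExact) {Y : C}
    [Subsingleton (Ext S.X₁ Y 1)] [Subsingleton (Ext S.X₃ Y 1)] :
    Subsingleton (Ext S.X₂ Y 1) := by
  refine subsingleton_of_forall_eq 0 fun x => ?_
  obtain ⟨y, rfl⟩ := Ext.contravariant_sequence_exact₂ hS Y x (Subsingleton.elim _ _)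
  rw [Subsingleton.elim y 0, Ext.comp_zero]

instance (B : ObjectProperty C) : (leftPerp B).IsClosedUnderIsomorphisms where
  of_iso e h Y hY := by
    have := h Y hY
    exact subsingleton_ext_of_iso e (Iso.refl Y)

instance (A : ObjectProperty C) : (rightPerp A).IsClosedUnderIsomorphisms where
  of_iso e h X hX := by
    have := h X hX
    exact subsingleton_ext_of_iso (Iso.refl X) e

namespace IsCompleteHereditary

variable {A B : ObjectProperty C} (h : IsCompleteHereditary A B)

include h

theorem subsingleton_ext {X Y : C} (hX : A X) (hY : B Y) : Subsingleton (Ext X Y 1) := by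
  rw [← h.right_eq] at hY
  exact hY X hX

theorem isClosedUnderIsomorphisms_left : A.IsClosedUnderIsomorphisms := by
  rw [← h.left_eq]
  infer_instance

theorem isClosedUnderIsomorphisms_right : B.IsClosedUnderIsomorphisms := by
  rw [← h.right_eq]
  infer_instance

theorem mem_left_of_projective (X : C) [Projective X] : A X := by
  rw [← h.left_eq]
  exact fun Y _ => Ext.subsingleton_of_projective X Y 0

theorem mem_right_of_injective (Y : C) [Injective Y] : B Y := by
  rw [← h.right_eq]
  exact fun X _ => Ext.subsingleton_of_injective X Y 0

theorem extension_mem_left {S : ShortComplex C} (hS : S.ShortExact) (h₁ : A S.X₁) (h₃ : A S.X₃) :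
    A S.X₂ := by
  rw [← h.left_eq]
  intro Y hY
  have := h.subsingleton_ext h₁ hY
  have := h.subsingleton_ext h₃ hY
  exact subsingleton_ext_left_of_shortExact hS

theorem extension_mem_right {S : ShortComplex C} (hS : S.ShortExact) (h₁ : B S.X₁)
    (h₃ : B S.X₃) : B S.X₂ := by
  rw [← h.right_eq]
  intro X hX
  have := h.subsingleton_ext hX h₁
  have := h.subsingleton_ext hX h₃
  exact subsingleton_ext_right_of_shortExact hS

end IsCompleteHereditary

section Opposite

open Opposite

variable [EnoughInjectives C] [HasExt.{w} Cᵒᵖ]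

theorem subsingleton_ext_op_iff (X Y : C) :
    Subsingleton (Ext (op Y) (op X) 1) ↔ Subsingleton (Ext X Y 1) := by
  let S := ShortComplex.mk (Injective.ι Y) (cokernel.π _) (cokernel.condition _)
  have hS : S.ShortExact :=
    { exact := S.exact_of_g_is_cokernel (cokernelIsCokernel _)
      mono_f := inferInstanceAs (Mono (Injective.ι Y))
      epi_g := inferInstanceAs (Epi (cokernel.π _)) }
  have : Subsingleton (Ext X S.X₂ 1) := Ext.subsingleton_of_injective X (Injective.under Y) 0
  have : Projective S.op.X₂ := inferInstanceAs (Projective (op (Injective.under Y)))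
  have : Subsingleton (Ext S.op.X₂ (op X) 1) := Ext.subsingleton_of_projective _ _ 0
  refine ⟨fun _ => subsingleton_ext_of_exists_lift hS fun φ => ?_,
    fun _ => subsingleton_ext_of_exists_extension hS.op fun φ => ?_⟩
  · have : Subsingleton (Ext S.op.X₃ (op X) 1) := ‹_›
    obtain ⟨ψ, hψ⟩ := exists_extension_of_subsingleton_ext hS.op φ.op
    exact ⟨ψ.unop, congrArg Quiver.Hom.unop hψ⟩
  · have : Subsingleton (Ext X S.X₁ 1) := ‹_›
    obtain ⟨ψ, hψ⟩ := exists_lift_of_subsingleton_ext hS φ.unop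
    exact ⟨ψ.op, congrArg Quiver.Hom.op hψ⟩

theorem IsCompleteHereditary.op {A B : ObjectProperty C} (h : IsCompleteHereditary A B) :
    IsCompleteHereditary B.op A.op where
  right_eq := by
    ext X
    rw [← h.left_eq]
    exact ⟨fun hX Y hY => (subsingleton_ext_op_iff _ _).1 (hX (.op Y) hY),
      fun hX Y hY => (subsingleton_ext_op_iff _ _).2 (hX _ hY)⟩
  left_eq := by
    ext Y
    rw [← h.right_eq]
    exact ⟨fun hY X hX => (subsingleton_ext_op_iff _ _).1 (hY (.op X) hX),
      fun hY X hX => (subsingleton_ext_op_iff _ _).2 (hY _ hX)⟩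
  exists_precover M := by
    obtain ⟨Y, X, i, p, hip, hY, hX, hS⟩ := h.exists_preenvelope M.unop
    exact ⟨.op X, .op Y, p.op, i.op, congrArg Quiver.Hom.op hip, hX, hY, hS.op⟩
  exists_preenvelope M := by
    obtain ⟨Y, X, i, p, hip, hY, hX, hS⟩ := h.exists_precover M.unop
    exact ⟨.op X, .op Y, p.op, i.op, congrArg Quiver.Hom.op hip, hX, hY, hS.op⟩
  kernel_mem S hS h₂ h₃ := h.cokernel_mem S.unop hS.unop h₃ h₂
  cokernel_mem S hS h₁ h₂ := h.kernel_mem S.unop hS.unop h₂ h₁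

end Opposite

end AbelianCotorsion

/-! ### The telescope of a tower in a triangulated category -/

namespace RelTriangulated

section Tower

variable {T : Type*} [Category* T] [Preadditive T] [HasProductsOfShape ℕ T]

/-- The endomorphism `1 - shift` of the product of the objects of an inverse tower; its fibre is
the homotopy limit of the tower. -/
def towerDiff {X : ℕ → T} (p : ∀ n, X (n + 1) ⟶ X n) : ∏ᶜ X ⟶ ∏ᶜ X :=
  𝟙 _ - Pi.lift fun n => Pi.π X (n + 1) ≫ p n

@[simp]
theorem towerDiff_π {X : ℕ → T} (p : ∀ n, X (n + 1) ⟶ X n) (n : ℕ) :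
    towerDiff p ≫ Pi.π X n = Pi.π X n - Pi.π X (n + 1) ≫ p n := by
  simp [towerDiff]

/-- The composite `X n ⟶ X 0` of the maps of an inverse tower. -/
def towerTo {X : ℕ → T} (p : ∀ n, X (n + 1) ⟶ X n) : ∀ n, X n ⟶ X 0
  | 0 => 𝟙 _
  | n + 1 => p n ≫ towerTo p n

theorem towerDiff_comp_map_towerTo {X : ℕ → T} (p : ∀ n, X (n + 1) ⟶ X n) :
    towerDiff p ≫ Limits.Pi.map (towerTo p) =
      Limits.Pi.map (towerTo p) ≫ towerDiff fun _ => 𝟙 (X 0) := by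
  refine Pi.hom_ext _ _ fun n => ?_
  simp [towerTo, reassoc_of% towerDiff_π, Preadditive.sub_comp]

/-- A section of `towerDiff` for a constant tower. -/
def constTowerSection (X : T) : (∏ᶜ fun _ : ℕ => X) ⟶ ∏ᶜ fun _ : ℕ => X :=
  Pi.lift fun n => -∑ i ∈ Finset.range n, Pi.π _ i

theorem constTowerSection_comp_towerDiff (X : T) :
    constTowerSection X ≫ towerDiff (fun _ => 𝟙 X) = 𝟙 _ := by
  refine Pi.hom_ext _ _ fun n => ?_
  simp [constTowerSection, Finset.sum_range_succ]

theorem towerDiff_comp_constTowerSection (X : T) :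
    towerDiff (fun _ => 𝟙 X) ≫ constTowerSection X =
      𝟙 _ - Pi.π _ 0 ≫ Pi.lift fun _ => 𝟙 X := by
  refine Pi.hom_ext _ _ fun n => ?_
  simp [constTowerSection, Preadditive.comp_sum, Preadditive.sub_comp,
    Finset.sum_range_sub' (fun i => Pi.π (fun _ : ℕ => X) i)]

end Tower

section Telescope

variable {T : Type*} [Category* T] [Preadditive T] [HasZeroObject T] [HasShift T ℤ]
  [∀ n : ℤ, (shiftFunctor T n).Additive] [Pretriangulated T] [HasProductsOfShape ℕ T]

theorem constTower_distinguished (X : T) :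
    Triangle.mk (Pi.lift fun _ : ℕ => 𝟙 X) (towerDiff fun _ => 𝟙 X) 0 ∈ distTriang T := by
  have diag_comp : (Pi.lift fun _ : ℕ => 𝟙 X) ≫ towerDiff (fun _ => 𝟙 X) = 0 := by
    refine Pi.hom_ext _ _ fun n => ?_
    simp
  have section_π : constTowerSection X ≫ Pi.π _ 0 = 0 := by simp [constTowerSection]
  let e : (∏ᶜ fun _ : ℕ => X) ≅ X ⊞ ∏ᶜ fun _ : ℕ => X :=
    { hom := biprod.lift (Pi.π _ 0) (towerDiff fun _ => 𝟙 X)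
      inv := biprod.desc (Pi.lift fun _ => 𝟙 X) (constTowerSection X)
      hom_inv_id := by simp [biprod.lift_desc, towerDiff_comp_constTowerSection]
      inv_hom_id := by
        ext <;> simp [diag_comp, section_π, constTowerSection_comp_towerDiff] }
  have diag_comp_e : (Pi.lift fun _ : ℕ => 𝟙 X) ≫ e.hom = biprod.inl := by
    ext <;> simp [e, diag_comp]
  exact isomorphic_distinguished _ (binaryBiproductTriangle_distinguished X _) _
    (Triangle.isoMk _ _ (Iso.refl _) e (Iso.refl _)
      (diag_comp_e.trans (Category.id_comp _).symm)
      ((Category.comp_id _).trans (biprod.lift_snd _ _).symm)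
      (zero_comp.trans comp_zero.symm))

variable (P : ObjectProperty T) [P.IsClosedUnderLimitsOfShape (Discrete ℕ)]

theorem trW_piMap {X Y : ℕ → T} {f : ∀ n, X n ⟶ Y n} (hf : ∀ n, P.trW (f n)) :
    P.trW (Limits.Pi.map f) := by
  choose Z g h hΔ hZ using hf
  exact ObjectProperty.trW.mk P
    (productTriangle_distinguished (fun n => Triangle.mk (f n) (g n) (h n)) hΔ)
    (P.prop_pi _ hZ)

theorem exists_trW_of_tower [IsTriangulated T] [P.IsTriangulated] {X : ℕ → T}
    {p : ∀ n, X (n + 1) ⟶ X n} (hp : ∀ n, P.trW (p n)) {L : T} {i : L ⟶ ∏ᶜ X}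
    {δ : ∏ᶜ X ⟶ L⟦(1 : ℤ)⟧} (hL : Triangle.mk i (towerDiff p) δ ∈ distTriang T) :
    ∃ f : L ⟶ X 0, P.trW f := by
  have hto (n : ℕ) : P.trW (towerTo p n) := by
    induction n with
    | zero => exact P.trW.id_mem _
    | succ n hn => exact P.trW.comp_mem _ _ (hp n) hn
  obtain ⟨c, hc, -, -⟩ := MorphismProperty.compatible_with_triangulation (W := P.trW) _ _
    (rot_of_distTriang _ hL) (rot_of_distTriang _ (constTower_distinguished (X 0))) _ _
    (trW_piMap P hto) (trW_piMap P hto) (towerDiff_comp_map_towerTo p)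
  obtain ⟨f, rfl⟩ := (shiftFunctor T (1 : ℤ)).map_surjective c
  exact ⟨f, hc.unshift⟩

end Telescope

end RelTriangulated

/-! ### Products in the homotopy category -/

namespace RelTriangulated

section HomotopyProducts

variable {C : Type*} [Category* C] [Preadditive C] {J : Type*} [HasProductsOfShape J C]

def isLimitPiX (K : J → CochainComplex C ℤ) (n : ℤ) :
    IsLimit (Fan.mk ((∏ᶜ K).X n) fun j => (Pi.π K j).f n) :=
  isLimitMapConeFanMkEquiv (HomologicalComplex.eval C _ n) K (Pi.π K)
    (isLimitOfPreserves _ (productIsProduct K))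

theorem lift_isLimitPiX_π {K : J → CochainComplex C ℤ} {n : ℤ} {X : C}
    (φ : ∀ j, X ⟶ (K j).X n) (j : J) :
    Fan.IsLimit.lift (isLimitPiX K n) φ ≫ (Pi.π K j).f n = φ j :=
  Fan.IsLimit.fac (isLimitPiX K n) φ j

def homotopyZeroOfComp {K : J → CochainComplex C ℤ} {L : CochainComplex C ℤ} (f : L ⟶ ∏ᶜ K)
    (h : ∀ j, Homotopy (f ≫ Pi.π K j) 0) : Homotopy f 0 where
  hom m n := Fan.IsLimit.lift (isLimitPiX K n) fun j => (h j).hom m n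
  zero m n hmn := Fan.IsLimit.hom_ext (isLimitPiX K n) _ _ fun j =>
    (lift_isLimitPiX_π _ j).trans (((h j).zero m n hmn).trans zero_comp.symm)
  comm n := Fan.IsLimit.hom_ext (isLimitPiX K n) _ _ fun j => by
    have hnext : (ComplexShape.up ℤ).Rel n (n + 1) := rfl
    have hprev : (ComplexShape.up ℤ).Rel (n - 1) n := sub_add_cancel n 1
    have := (h j).comm n
    rw [dNext_eq _ hnext, prevD_eq _ hprev] at this
    simpa [dNext_eq _ hnext, prevD_eq _ hprev, lift_isLimitPiX_π, reassoc_of% lift_isLimitPiX_π,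
      ← HomologicalComplex.Hom.comm] using this

variable {K : J → CochainComplex C ℤ} {L : HomotopyCategory C (.up ℤ)}

theorem exists_lift_quotient_pi
    (φ : ∀ j, L ⟶ (HomotopyCategory.quotient C (.up ℤ)).obj (K j)) :
    ∃ f : L ⟶ (HomotopyCategory.quotient C (.up ℤ)).obj (∏ᶜ K),
      ∀ j, f ≫ (HomotopyCategory.quotient C (.up ℤ)).map (Pi.π K j) = φ j := by
  obtain ⟨L, rfl⟩ := HomotopyCategory.quotient_obj_surjective L
  choose g hg using fun j => (HomotopyCategory.quotient C (.up ℤ)).map_surjective (φ j)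
  exact ⟨(HomotopyCategory.quotient C (.up ℤ)).map (Pi.lift g), fun j => by
    rw [← Functor.map_comp, Pi.lift_π, hg]⟩

theorem eq_of_comp_quotient_map_π {f g : L ⟶ (HomotopyCategory.quotient C (.up ℤ)).obj (∏ᶜ K)}
    (h : ∀ j, f ≫ (HomotopyCategory.quotient C (.up ℤ)).map (Pi.π K j) =
      g ≫ (HomotopyCategory.quotient C (.up ℤ)).map (Pi.π K j)) : f = g := by
  obtain ⟨L, rfl⟩ := HomotopyCategory.quotient_obj_surjective L
  obtain ⟨f, rfl⟩ := (HomotopyCategory.quotient C (.up ℤ)).map_surjective f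
  obtain ⟨g, rfl⟩ := (HomotopyCategory.quotient C (.up ℤ)).map_surjective g
  refine HomotopyCategory.eq_of_homotopy _ _ (Homotopy.equivSubZero.symm
    (homotopyZeroOfComp _ fun j => ?_))
  simp only [← Functor.map_comp] at h
  exact (Homotopy.ofEq (Preadditive.sub_comp _ _ _)).trans
    (Homotopy.equivSubZero (HomotopyCategory.homotopyOfEq _ _ (h j)))

variable (K) in
def isLimitQuotientPi :
    IsLimit (Fan.mk ((HomotopyCategory.quotient C (.up ℤ)).obj (∏ᶜ K)) fun j =>
      (HomotopyCategory.quotient C (.up ℤ)).map (Pi.π K j)) :=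
  Fan.IsLimit.mk _ (fun s => (exists_lift_quotient_pi s.proj).choose)
    (fun s => (exists_lift_quotient_pi s.proj).choose_spec)
    (fun s _ hm => eq_of_comp_quotient_map_π fun j =>
      (hm j).trans ((exists_lift_quotient_pi s.proj).choose_spec j).symm)

instance : HasProductsOfShape J (HomotopyCategory C (.up ℤ)) where
  has_limit F := by
    let F' := Discrete.functor fun j =>
      (HomotopyCategory.quotient C (.up ℤ)).obj (F.obj ⟨j⟩).as
    have : HasLimit F' := ⟨⟨_, isLimitQuotientPi fun j => (F.obj ⟨j⟩).as⟩⟩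
    exact hasLimit_of_iso (F := F') (Discrete.natIso fun _ => Iso.refl _)

end HomotopyProducts

end RelTriangulated

/-! ### Semi-injective objects of the homotopy category -/

namespace RelTriangulated

open HomotopyCategory ZeroObject

section SemiInjective

variable {C : Type*} [Category* C] [Abelian C]

variable (C) in
/-- The homotopy classes of complexes with injective terms; this is not closed under isomorphisms
in the homotopy category. -/
def injectiveTerms : ObjectProperty (HomotopyCategory C (.up ℤ)) :=
  fun K => ∀ n, Injective (K.as.X n)

instance : (injectiveTerms C).ContainsZero where
  exists_zero := ⟨(quotient C (.up ℤ)).obj (0 : CochainComplex C ℤ),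
    Functor.map_isZero _ (isZero_zero _),
    fun n => (Functor.map_isZero (HomologicalComplex.eval C _ n) (isZero_zero _)).injective⟩

instance : (injectiveTerms C).IsStableUnderShift ℤ where
  isStableUnderShiftBy n := ⟨fun K hK => by
    obtain ⟨K : CochainComplex C ℤ, rfl⟩ := K.quotient_obj_surjective
    rw [ObjectProperty.prop_shift_iff, shift_quotient_obj]
    exact fun s => hK (s + n)⟩

theorem injective_mappingCone_X {K L : CochainComplex C ℤ} (f : K ⟶ L)
    (hK : ∀ n, Injective (K.X n)) (hL : ∀ n, Injective (L.X n)) (n : ℤ) :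
    Injective ((CochainComplex.mappingCone f).X n) :=
  have := hK (n + 1)
  have := hL n
  Injective.of_iso (HomologicalComplex.homotopyCofiber.XIsoBiprod f n (n + 1) rfl).symm
    inferInstance

instance : (injectiveTerms C).IsTriangulatedClosed₃ where
  ext₃' Δ hΔ h₁ h₂ := by
    obtain ⟨f, hf⟩ : ∃ f : Δ.obj₁.as ⟶ Δ.obj₂.as, (quotient C (.up ℤ)).map f = Δ.mor₁ :=
      (quotient C (.up ℤ)).map_surjective _
    exact ⟨_, injective_mappingCone_X f h₁ h₂,
      ⟨Triangle.π₃.mapIso (isoTriangleOfIso₁₂ Δ _ hΔ (mappingCone_triangleh_distinguished f)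
        (Iso.refl _) (Iso.refl _)
        ((Category.comp_id _).trans (hf.symm.trans (Category.id_comp _).symm)))⟩⟩

instance : (injectiveTerms C).IsTriangulated where
  toIsTriangulatedClosed₂ := .of_isTriangulatedClosed₃

variable (C) in
/-- The objects of the homotopy category that are represented by K-injective complexes with
injective terms. -/
def semiInjective : ObjectProperty (HomotopyCategory C (.up ℤ)) :=
  (injectiveTerms C).isoClosure ⊓ (subcategoryAcyclic C).rightOrthogonal

instance : (semiInjective C).IsTriangulated :=
  inferInstanceAs ((injectiveTerms C).isoClosure ⊓ _).IsTriangulated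

theorem semiInjective_quotient_obj (I : CochainComplex C ℤ) [I.IsKInjective]
    (hI : ∀ n, Injective (I.X n)) : semiInjective C ((quotient C (.up ℤ)).obj I) :=
  ⟨(injectiveTerms C).le_isoClosure _ hI, CochainComplex.IsKInjective.rightOrthogonal I⟩

theorem exists_of_semiInjective {K : HomotopyCategory C (.up ℤ)} (hK : semiInjective C K) :
    ∃ I : CochainComplex C ℤ, (∀ n, Injective (I.X n)) ∧ I.IsKInjective ∧
      Nonempty (K ≅ (quotient C (.up ℤ)).obj I) := by
  obtain ⟨⟨I, hI, ⟨e⟩⟩, h⟩ := hK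
  exact ⟨I.as, hI, (CochainComplex.isKInjective_iff_rightOrthogonal _).2
    (ObjectProperty.prop_of_iso _ e h), ⟨e⟩⟩

instance {J : Type*} [HasProductsOfShape J C] :
    (semiInjective C).IsClosedUnderLimitsOfShape (Discrete J) where
  limitsOfShape_le := by
    rintro X ⟨pX⟩
    choose I hI e using fun j => (pX.prop_diag_obj ⟨j⟩).1
    refine ⟨⟨(quotient C (.up ℤ)).obj (∏ᶜ fun j => (I j).as), fun n => ?_, ⟨?_⟩⟩, fun A f hA => ?_⟩
    · have := fun j => hI j n
      exact Injective.of_iso ((productIsProduct _).conePointUniqueUpToIso (isLimitPiX _ n))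
        (inferInstanceAs (Injective (∏ᶜ fun j => (I j).as.X n)))
    · exact pX.isLimit.conePointsIsoOfNatIso (isLimitQuotientPi fun j => (I j).as)
        (Discrete.natIso fun j => (e j.as).some)
    · exact pX.isLimit.hom_ext fun j =>
        ((pX.prop_diag_obj j).2 _ hA).trans zero_comp.symm

end SemiInjective

end RelTriangulated

/-! ### Complexes with zero differential -/

namespace AbelianCotorsion

section ZeroDifferential

open HomologicalComplex

variable {C : Type*} [Category* C] [Abelian C]

/-- The complex with terms `F s` and zero differential. -/
def zeroDiff (F : ℤ → C) : CochainComplex C ℤ where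
  X := F
  d _ _ := 0

variable {F Y : CochainComplex C ℤ}

theorem isIso_iCycles_of_d_eq_zero (hF : ∀ i j, F.d i j = 0) (s : ℤ) : IsIso (F.iCycles s) :=
  F.isIso_iCycles s (s + 1) (by simp) (hF _ _)

theorem isIso_pOpcycles_of_d_eq_zero (hF : ∀ i j, F.d i j = 0) (s : ℤ) : IsIso (F.pOpcycles s) :=
  F.isIso_pOpcycles (s - 1) s (by simp) (hF _ _)

theorem isIso_homologyπ_of_d_eq_zero (hF : ∀ i j, F.d i j = 0) (s : ℤ) :
    IsIso (F.homologyπ s) :=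
  F.isIso_homologyπ (s - 1) s (by simp) (hF _ _)

theorem isIso_homologyι_of_d_eq_zero (hF : ∀ i j, F.d i j = 0) (s : ℤ) :
    IsIso (F.homologyι s) :=
  F.isIso_homologyι s (s + 1) (by simp) (hF _ _)

theorem exists_hom_of_homology_of_projective (hF : ∀ i j, F.d i j = 0)
    [∀ s, Projective (F.X s)] (φ : ∀ s, F.homology s ⟶ Y.homology s) :
    ∃ f : F ⟶ Y, ∀ s, homologyMap f s = φ s := by
  have := isIso_iCycles_of_d_eq_zero hF
  have := isIso_homologyπ_of_d_eq_zero hF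
  let l (s : ℤ) : F.X s ⟶ Y.cycles s :=
    Projective.factorThru (inv (F.iCycles s) ≫ F.homologyπ s ≫ φ s) (Y.homologyπ s)
  let f : F ⟶ Y :=
    { f s := l s ≫ Y.iCycles s
      comm' i j _ := by simp [hF] }
  refine ⟨f, fun s => ?_⟩
  have h : cyclesMap f s = F.iCycles s ≫ l s := by
    simp [← cancel_mono (Y.iCycles s), f]
  rw [← cancel_epi (F.homologyπ s), homologyπ_naturality, h]
  simp [l]

theorem exists_hom_of_homology_of_injective (hF : ∀ i j, F.d i j = 0)
    [∀ s, Injective (F.X s)] (φ : ∀ s, Y.homology s ⟶ F.homology s) :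
    ∃ f : Y ⟶ F, ∀ s, homologyMap f s = φ s := by
  have := isIso_pOpcycles_of_d_eq_zero hF
  have := isIso_homologyι_of_d_eq_zero hF
  let l (s : ℤ) : Y.opcycles s ⟶ F.X s :=
    Injective.factorThru (φ s ≫ F.homologyι s ≫ inv (F.pOpcycles s)) (Y.homologyι s)
  let f : Y ⟶ F :=
    { f s := Y.pOpcycles s ≫ l s
      comm' i j _ := by simp [hF] }
  refine ⟨f, fun s => ?_⟩
  have h : opcyclesMap f s = l s ≫ F.pOpcycles s := by
    simp [← cancel_epi (Y.pOpcycles s), f]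
  rw [← cancel_mono (F.homologyι s), homologyι_naturality, h]
  simp [l]

theorem nonempty_homotopy_zero_of_projective (hF : ∀ i j, F.d i j = 0)
    [∀ s, Projective (F.X s)] (f : F ⟶ Y) (hf : ∀ s, homologyMap f s = 0) :
    Nonempty (Homotopy f 0) := by
  have := isIso_iCycles_of_d_eq_zero hF
  have exists_comp_d (i j : ℤ) (hij : (ComplexShape.up ℤ).Rel j i) :
      ∃ k : F.X i ⟶ Y.X j, k ≫ Y.d j i = f.f i := by
    have exact : (ShortComplex.mk (Y.toCycles j i) (Y.homologyπ i) (by simp)).Exact :=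
      ShortComplex.exact_of_g_is_cokernel _
        (Y.homologyIsCokernel j i ((ComplexShape.up ℤ).prev_eq' hij))
    have hπ : (inv (F.iCycles i) ≫ cyclesMap f i) ≫ Y.homologyπ i = 0 := by
      simp [← homologyπ_naturality, hf]
    refine ⟨exact.liftFromProjective _ hπ, ?_⟩
    have := exact.liftFromProjective_comp _ hπ
    dsimp at this
    rw [← Y.toCycles_i j i, reassoc_of% this]
    simp
  choose k hk using exists_comp_d
  refine ⟨(Homotopy.ofEq ?_).trans (Homotopy.nullHomotopy' k)⟩
  ext i
  rw [Homotopy.nullHomotopicMap'_f (k₂ := i - 1) (k₁ := i) (k₀ := i + 1) (by simp) (by simp),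
    hk, hF]
  simp

theorem nonempty_homotopy_zero_of_injective (hF : ∀ i j, F.d i j = 0)
    [∀ s, Injective (F.X s)] (f : Y ⟶ F) (hf : ∀ s, homologyMap f s = 0) :
    Nonempty (Homotopy f 0) := by
  have := isIso_pOpcycles_of_d_eq_zero hF
  have exists_d_comp (i j : ℤ) (hij : (ComplexShape.up ℤ).Rel i j) :
      ∃ k : Y.X j ⟶ F.X i, Y.d i j ≫ k = f.f i := by
    have exact : (ShortComplex.mk (Y.homologyι i) (Y.fromOpcycles i j) (by simp)).Exact :=
      ShortComplex.exact_of_f_is_kernel _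
        (Y.homologyIsKernel i j ((ComplexShape.up ℤ).next_eq' hij))
    have hι : Y.homologyι i ≫ opcyclesMap f i ≫ inv (F.pOpcycles i) = 0 := by
      simp [← homologyι_naturality_assoc, hf]
    refine ⟨exact.descToInjective _ hι, ?_⟩
    have := exact.comp_descToInjective _ hι
    dsimp at this
    rw [← Y.p_fromOpcycles i j, Category.assoc, this]
    simp
  choose k hk using exists_d_comp
  refine ⟨(Homotopy.ofEq ?_).trans (Homotopy.nullHomotopy' fun i j hij => k j i hij)⟩
  ext i
  rw [Homotopy.nullHomotopicMap'_f (k₂ := i - 1) (k₁ := i) (k₀ := i + 1) (by simp) (by simp),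
    hk, hF]
  simp

theorem isKInjective_of_d_eq_zero (hF : ∀ i j, F.d i j = 0) [∀ s, Injective (F.X s)] :
    F.IsKInjective where
  nonempty_homotopy_zero f hK := nonempty_homotopy_zero_of_injective hF f fun s =>
    ((HomologicalComplex.exactAt_iff_isZero_homology _ _).1 (hK s)).eq_zero_of_src _

theorem exists_mono_homologyMap_to_injective [EnoughInjectives C] (K : CochainComplex C ℤ) :
    ∃ (F : CochainComplex C ℤ) (f : K ⟶ F), (∀ i j, F.d i j = 0) ∧ (∀ s, Injective (F.X s)) ∧
      ∀ s, Mono (homologyMap f s) := by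
  let F : CochainComplex C ℤ := zeroDiff fun s => Injective.under (K.opcycles s)
  let φ (s : ℤ) : K.opcycles s ⟶ F.X s := Injective.ι (K.opcycles s)
  have (s : ℤ) : Mono (φ s) := Injective.ι_mono _
  let f : K ⟶ F :=
    { f s := K.pOpcycles s ≫ φ s
      comm' i j _ := by simp [show F.d i j = 0 from rfl] }
  refine ⟨F, f, fun _ _ => rfl, fun s => Injective.injective_under _, fun s => ?_⟩
  have := isIso_pOpcycles_of_d_eq_zero (F := F) (fun _ _ => rfl) s
  have hmap : opcyclesMap f s = φ s ≫ F.pOpcycles s := by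
    simp [← cancel_epi (K.pOpcycles s), f]
  have : Mono (homologyMap f s ≫ F.homologyι s) := by
    rw [homologyι_naturality, hmap]
    infer_instance
  exact mono_of_mono _ (F.homologyι s)

end ZeroDifferential

end AbelianCotorsion

/-! ### Semi-injective resolutions -/

namespace RelTriangulated

section Refinements

variable {C : Type*} [Category* C] [Abelian C] {J : Type*} [HasProductsOfShape J C]
  [HasExactLimitsOfShape (Discrete J) C]

theorem epi_piMap {A B : J → C} (e : ∀ j, B j ⟶ A j) [∀ j, Epi (e j)] :
    Epi (Limits.Pi.map e) := by
  let α : Discrete.functor B ⟶ Discrete.functor A := Discrete.natTrans fun j => e j.as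
  have (j : Discrete J) : Epi (α.app j) := inferInstanceAs (Epi (e j.as))
  have : Epi α := NatTrans.epi_of_epi_app α
  exact inferInstanceAs (Epi (lim.map α))

theorem exists_common_refinement {A : C} {B : J → C} (e : ∀ j, B j ⟶ A) [∀ j, Epi (e j)] :
    ∃ (A' : C) (π : A' ⟶ A) (_ : Epi π) (g : ∀ j, A' ⟶ B j), ∀ j, g j ≫ e j = π := by
  have := epi_piMap e
  let Δ : A ⟶ ∏ᶜ fun _ : J => A := Pi.lift fun _ => 𝟙 A
  refine ⟨_, pullback.snd (Limits.Pi.map e) Δ, inferInstance,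
    fun j => pullback.fst (Limits.Pi.map e) Δ ≫ Pi.π B j, fun j => ?_⟩
  rw [Category.assoc, ← Pi.map_π, pullback.condition_assoc, Pi.lift_π, Category.comp_id]

theorem eq_zero_of_comp_homologyMap_π {K : J → CochainComplex C ℤ} {s : ℤ} {A : C}
    (x : A ⟶ (∏ᶜ K).homology s)
    (hx : ∀ j, x ≫ HomologicalComplex.homologyMap (Pi.π K j) s = 0) : x = 0 := by
  have hprev : (ComplexShape.up ℤ).prev s = s - 1 := by simp
  obtain ⟨A₁, π₁, _, z, hz, hxz⟩ :=
    (∏ᶜ K).eq_liftCycles_homologyπ_up_to_refinements x (s + 1) (by simp)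
  have boundary (j : J) : ∃ (A₂ : C) (π₂ : A₂ ⟶ A₁) (_ : Epi π₂) (y : A₂ ⟶ (K j).X (s - 1)),
      π₂ ≫ z ≫ (Pi.π K j).f s = y ≫ (K j).d (s - 1) s := by
    refine ((K j).liftCycles_comp_homologyπ_eq_zero_iff_up_to_refinements (s - 1) s (s + 1)
      hprev (by simp) _ (by rw [Category.assoc, HomologicalComplex.Hom.comm, reassoc_of% hz,
        zero_comp])).1 ?_
    have := congrArg (· ≫ HomologicalComplex.homologyMap (Pi.π K j) s) hxz
    simpa [hx j] using this.symm
  choose A₂ π₂ hπ₂ y hy using boundary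
  obtain ⟨A₃, π₃, _, g, hg⟩ := exists_common_refinement π₂
  have hlift : π₃ ≫ z =
      Fan.IsLimit.lift (isLimitPiX K (s - 1)) (fun j => g j ≫ y j) ≫ (∏ᶜ K).d (s - 1) s := by
    refine Fan.IsLimit.hom_ext (isLimitPiX K s) _ _ fun j => ?_
    dsimp
    rw [Category.assoc, Category.assoc, ← HomologicalComplex.Hom.comm,
      reassoc_of% lift_isLimitPiX_π, Category.assoc, ← hy, reassoc_of% hg]
  have hz₀ := ((∏ᶜ K).liftCycles_comp_homologyπ_eq_zero_iff_up_to_refinements (s - 1) s (s + 1)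
    hprev (by simp) z hz).2 ⟨A₃, π₃, inferInstance, _, hlift⟩
  rw [← cancel_epi π₁, hxz, hz₀, comp_zero]

theorem homologyFunctor_map_eq_zero_of_comp_π {X : J → HomotopyCategory C (.up ℤ)}
    {L : HomotopyCategory C (.up ℤ)} (f : L ⟶ ∏ᶜ X) (s : ℤ)
    (hf : ∀ j, (HomotopyCategory.homologyFunctor C _ s).map (f ≫ Pi.π X j) = 0) :
    (HomotopyCategory.homologyFunctor C _ s).map f = 0 := by
  obtain ⟨K, rfl⟩ : ∃ K, X = fun j => (HomotopyCategory.quotient C (.up ℤ)).obj (K j) :=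
    ⟨fun j => (X j).as, rfl⟩
  let e := (productIsProduct _).conePointUniqueUpToIso (isLimitQuotientPi K)
  have e_hom_π (j : J) : e.hom ≫ (HomotopyCategory.quotient C (.up ℤ)).map (Pi.π K j) = Pi.π _ j :=
    (productIsProduct _).conePointUniqueUpToIso_hom_comp (isLimitQuotientPi K) ⟨j⟩
  let N := HomotopyCategory.homologyFunctorFactors C (.up ℤ) s
  rw [← cancel_mono ((HomotopyCategory.homologyFunctor C _ s).map e.hom), zero_comp,
    ← cancel_mono (N.hom.app (∏ᶜ K)), zero_comp]
  refine eq_zero_of_comp_homologyMap_π _ fun j => ?_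
  have hπ : ((HomotopyCategory.homologyFunctor C _ s).map f ≫
      (HomotopyCategory.homologyFunctor C _ s).map e.hom) ≫
        (HomotopyCategory.homologyFunctor C _ s).map
          ((HomotopyCategory.quotient C (.up ℤ)).map (Pi.π K j)) = 0 := by
    rw [← Functor.map_comp, ← Functor.map_comp, Category.assoc, e_hom_π, hf]
  have naturality := N.hom.naturality (Pi.π K j)
  exact (Category.assoc _ _ _).trans ((congrArg _ naturality.symm).trans
    ((Category.assoc _ _ _).symm.trans ((congrArg (· ≫ N.hom.app (K j)) hπ).trans zero_comp)))

end Refinements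

section Resolutions

open HomotopyCategory

variable {C : Type*} [Category* C] [Abelian C]

theorem exists_triangle_to_injective [EnoughInjectives C] (X : HomotopyCategory C (.up ℤ)) :
    ∃ (F : CochainComplex C ℤ) (X' : HomotopyCategory C (.up ℤ)) (p : X' ⟶ X)
      (f : X ⟶ (quotient C (.up ℤ)).obj F) (δ : (quotient C (.up ℤ)).obj F ⟶ X'⟦(1 : ℤ)⟧),
      Triangle.mk p f δ ∈ distTriang _ ∧ (∀ i j, F.d i j = 0) ∧ (∀ s, Injective (F.X s)) ∧
        ∀ s, Mono ((homologyFunctor C (.up ℤ) s).map f) := by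
  obtain ⟨K, rfl⟩ := X.quotient_obj_surjective
  obtain ⟨F, f, hd, hF, hf⟩ := AbelianCotorsion.exists_mono_homologyMap_to_injective K
  obtain ⟨X', p, δ, hΔ⟩ := distinguished_cocone_triangle₁ ((quotient C (.up ℤ)).map f)
  exact ⟨F, X', p, _, δ, hΔ, hd, hF, fun s =>
    ((MorphismProperty.monomorphisms C).arrow_mk_iso_iff
      (Arrow.isoOfNatIso (homologyFunctorFactors C (.up ℤ) s) (Arrow.mk f))).2 (hf s)⟩

theorem homologyFunctor_map_mor₁_eq_zero {Δ : Triangle (HomotopyCategory C (.up ℤ))}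
    (hΔ : Δ ∈ distTriang _) {s : ℤ} (h : Mono ((homologyFunctor C (.up ℤ) s).map Δ.mor₂)) :
    (homologyFunctor C (.up ℤ) s).map Δ.mor₁ = 0 := by
  rw [← cancel_mono ((homologyFunctor C (.up ℤ) s).map Δ.mor₂), zero_comp, ← Functor.map_comp,
    comp_distTriang_mor_zero₁₂ _ hΔ, Functor.map_zero]

theorem exists_trW_homologyFunctor_map_eq_zero [EnoughInjectives C]
    (X : HomotopyCategory C (.up ℤ)) :
    ∃ (X' : HomotopyCategory C (.up ℤ)) (p : X' ⟶ X), (semiInjective C).trW p ∧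
      ∀ s, (homologyFunctor C _ s).map p = 0 := by
  obtain ⟨F, X', p, f, δ, hΔ, hd, hF, hf⟩ := exists_triangle_to_injective X
  have := AbelianCotorsion.isKInjective_of_d_eq_zero hd
  exact ⟨X', p, .mk _ hΔ (semiInjective_quotient_obj F hF),
    fun s => homologyFunctor_map_mor₁_eq_zero hΔ (hf s)⟩

variable [HasProductsOfShape ℕ C] [HasExactLimitsOfShape (Discrete ℕ) C]

theorem trW_subcategoryAcyclic_towerDiff {X : ℕ → HomotopyCategory C (.up ℤ)}
    {p : ∀ n, X (n + 1) ⟶ X n} (hp : ∀ n s, (homologyFunctor C _ s).map (p n) = 0) :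
    (subcategoryAcyclic C).trW (towerDiff p) := by
  rw [← quasiIso_eq_trW_subcategoryAcyclic, mem_quasiIso_iff]
  intro s
  rw [towerDiff, Functor.map_sub, homologyFunctor_map_eq_zero_of_comp_π (Pi.lift _) s fun n => by
    rw [Pi.lift_π, Functor.map_comp, hp, comp_zero], sub_zero]
  infer_instance

theorem exists_semiInjective_resolution [EnoughInjectives C] (K : CochainComplex C ℤ) :
    ∃ (I : CochainComplex C ℤ) (f : K ⟶ I), (∀ n, Injective (I.X n)) ∧ I.IsKInjective ∧
      QuasiIso f := by
  choose F p hp hp₀ using exists_trW_homologyFunctor_map_eq_zero (C := C)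
  let X (n : ℕ) : HomotopyCategory C (.up ℤ) := n.rec ((quotient C _).obj K) fun _ => F
  obtain ⟨L, i, δ, hL⟩ := distinguished_cocone_triangle₁ (towerDiff (X := X) fun n => p (X n))
  have L_acyclic : subcategoryAcyclic C L :=
    ((subcategoryAcyclic C).trW_iff_of_distinguished' _ hL).1
      (trW_subcategoryAcyclic_towerDiff fun n => hp₀ (X n))
  obtain ⟨g, S, q, _, hS, S_mem⟩ := exists_trW_of_tower (semiInjective C) (fun n => hp (X n)) hL
  obtain ⟨I, hI, hI', ⟨e⟩⟩ := exists_of_semiInjective S_mem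
  obtain ⟨f, hf⟩ := (quotient C (.up ℤ)).map_surjective (q ≫ e.hom)
  refine ⟨I, f, hI, hI', ?_⟩
  rw [← HomologicalComplex.mem_quasiIso_iff, ← quotient_map_mem_quasiIso_iff, hf,
    quasiIso_eq_trW_subcategoryAcyclic]
  exact MorphismProperty.RespectsIso.postcomp _ e.hom _
    (ObjectProperty.trW.mk' _ hS L_acyclic)

end Resolutions

end RelTriangulated

/-! ### Duality and semi-projective resolutions -/

namespace RelTriangulated

section OppositeProducts

open MorphismProperty Opposite

variable {C : Type*} [Category* C] {J : Type*}

theorem pi_map_op [HasCoproductsOfShape J C] {X Y : J → C} (f : ∀ j, Y j ⟶ X j) :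
    Limits.Pi.map (fun j => (f j).op) = (opCoproductIsoProduct X).inv ≫
      (Limits.Sigma.map f).op ≫ (opCoproductIsoProduct Y).hom := by
  rw [Iso.eq_inv_comp]
  refine Pi.hom_ext _ _ fun j => ?_
  rw [Category.assoc, Category.assoc, Pi.map_π, opCoproductIsoProduct_hom_comp_π,
    ← Category.assoc, opCoproductIsoProduct_hom_comp_π, ← op_comp, ← op_comp, Sigma.ι_map]

theorem isStableUnderProductsOfShape_epimorphisms_op [HasCoproductsOfShape J C]
    [(monomorphisms C).IsStableUnderCoproductsOfShape J] :
    (epimorphisms Cᵒᵖ).IsStableUnderProductsOfShape J := by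
  refine .mk _ J fun X Y _ _ f hf => ?_
  have (j : J) : Epi (f j) := hf j
  have : Mono (Limits.Sigma.map fun j => (f j).unop) :=
    MorphismProperty.colimMap (W := monomorphisms C) _ fun j =>
      inferInstanceAs (Mono (f j.as).unop)
  rw [epimorphisms.iff, show Limits.Pi.map f = _ from pi_map_op fun j => (f j).unop]
  infer_instance

theorem hasExactLimitsOfShape_discrete_op [Abelian C] [HasCoproductsOfShape J C]
    [HasExactColimitsOfShape (Discrete J) C] : HasExactLimitsOfShape (Discrete J) Cᵒᵖ := by
  have := isStableUnderProductsOfShape_epimorphisms_op (C := C) (J := J)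
  have : (lim (J := Discrete J) (C := Cᵒᵖ)).PreservesEpimorphisms :=
    ⟨fun α _ => MorphismProperty.limMap (W := epimorphisms Cᵒᵖ) α fun j =>
      inferInstanceAs (Epi (α.app j))⟩
  exact hasExactLimitsOfShape_of_preservesEpi _ _

end OppositeProducts

section Opposite

open Opposite CochainComplex

variable {C : Type*} [Category* C] [Abelian C]

/-- The complex of `Cᵒᵖ` with `X s = op (K.X (-s))`, through which statements on injective objects
are transported to projective ones. -/
abbrev opComplex (K : CochainComplex C ℤ) : CochainComplex Cᵒᵖ ℤ :=
  (opEquivalence C).functor.obj (op K)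

theorem quasiIso_of_quasiIso_op {K L : CochainComplex C ℤ} {f : K ⟶ L}
    (hf : QuasiIso ((opEquivalence C).functor.map f.op)) : QuasiIso f := by
  refine ⟨fun s => ?_⟩
  obtain ⟨s, rfl⟩ := neg_surjective s
  rw [quasiIsoAt_iff' f (-(s + 1)) (-s) (-(s - 1)) (by simp [neg_add_eq_sub]) (by simp; lia),
    ← ShortComplex.quasiIso_opMap_iff]
  exact (quasiIsoAt_iff' _ (s - 1) s (s + 1) (by simp) (by simp)).1 (hf.quasiIsoAt s)

theorem nonempty_homology_opComplex_iso (K : CochainComplex C ℤ) (s : ℤ) :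
    Nonempty ((opComplex K).homology s ≅ op (K.homology (-s))) :=
  ⟨ShortComplex.homologyMapIso ((opComplex K).isoSc' (s - 1) s (s + 1) (by simp) (by simp)) ≪≫
    (K.sc' (-(s + 1)) (-s) (-(s - 1))).homologyOpIso ≪≫
    (ShortComplex.homologyMapIso (K.isoSc' (-(s + 1)) (-s) (-(s - 1))
      (by simp [neg_add_eq_sub]) (by simp; lia))).op⟩

theorem nonempty_opcycles_opComplex_iso (K : CochainComplex C ℤ) (s : ℤ) :
    Nonempty ((opComplex K).opcycles s ≅ op (K.cycles (-s))) :=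
  ⟨(opComplex K).opcyclesIsoSc' (s - 1) s (s + 1) (by simp) (by simp) ≪≫
    (K.sc' (-(s + 1)) (-s) (-(s - 1))).opcyclesOpIso ≪≫
    (K.cyclesIsoSc' (-(s + 1)) (-s) (-(s - 1)) (by simp [neg_add_eq_sub]) (by simp; lia)).op⟩

theorem acyclic_of_acyclic_opComplex {K : CochainComplex C ℤ} (hK : (opComplex K).Acyclic) :
    K.Acyclic := by
  intro s
  obtain ⟨s, rfl⟩ := neg_surjective s
  obtain ⟨e⟩ := nonempty_homology_opComplex_iso K s
  rw [K.exactAt_iff_isZero_homology]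
  exact (((opComplex K).exactAt_iff_isZero_homology s).1 (hK s) |>.of_iso e.symm).unop

theorem exists_opComplex_iso (L : CochainComplex Cᵒᵖ ℤ) :
    ∃ K : CochainComplex C ℤ, Nonempty (opComplex K ≅ L) :=
  ⟨((opEquivalence C).inverse.obj L).unop, ⟨(opEquivalence C).counitIso.app L⟩⟩

theorem isKProjective_opComplex {I : CochainComplex C ℤ} (hI : I.IsKInjective) :
    (opComplex I).IsKProjective where
  nonempty_homotopy_zero {L} f hL := by
    obtain ⟨K, ⟨e⟩⟩ := exists_opComplex_iso L
    obtain ⟨g, hg⟩ := (opEquivalence C).functor.map_surjective (f ≫ e.inv)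
    have K_acyclic : K.Acyclic := acyclic_of_acyclic_opComplex fun s => (hL s).of_iso e.symm
    obtain ⟨h⟩ := hI.nonempty_homotopy_zero g.unop K_acyclic
    have h' : Homotopy (f ≫ e.inv) 0 :=
      (Homotopy.ofEq hg.symm).trans ((homotopyOp h).trans (.ofEq (by simp)))
    exact ⟨(Homotopy.ofEq (by simp)).trans ((h'.compRight e.hom).trans (.ofEq zero_comp))⟩

theorem exists_semiProjective_resolution [EnoughProjectives C] [HasCoproductsOfShape ℕ C]
    [HasExactColimitsOfShape (Discrete ℕ) C] (K : CochainComplex C ℤ) :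
    ∃ (P : CochainComplex C ℤ) (f : P ⟶ K), (∀ n, Projective (P.X n)) ∧ P.IsKProjective ∧
      QuasiIso f := by
  have := hasExactLimitsOfShape_discrete_op (C := C) (J := ℕ)
  obtain ⟨I, f, I_injective, I_isKInjective, hf⟩ := exists_semiInjective_resolution (opComplex K)
  obtain ⟨P, ⟨e⟩⟩ := exists_opComplex_iso I
  obtain ⟨g, hg⟩ := (opEquivalence C).functor.map_surjective (f ≫ e.inv)
  refine ⟨P, g.unop, fun n => ?_, isKProjective_of_op (isKInjective_of_iso e.symm),
    quasiIso_of_quasiIso_op ?_⟩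
  · obtain ⟨n, rfl⟩ := neg_surjective n
    have : Injective (op (P.X (-n))) := Injective.of_iso
      ((HomologicalComplex.eval _ _ n).mapIso e.symm) (I_injective n)
    exact inferInstanceAs (Projective (unop (op (P.X (-n)))))
  · rw [Quiver.Hom.op_unop, hg]
    infer_instance

end Opposite

end RelTriangulated

/-! ### Maps that vanish in cohomology -/

namespace RelTriangulated

theorem exists_distinguished_of_iso_shift {T : Type*} [Category* T] [Preadditive T]
    [HasZeroObject T] [HasShift T ℤ] [∀ n : ℤ, (shiftFunctor T n).Additive] [Pretriangulated T]
    {X Y Z W : T} {f : X ⟶ Y} {g : Y ⟶ Z} {h : Z ⟶ X⟦(1 : ℤ)⟧}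
    (hΔ : Triangle.mk f g h ∈ distTriang T) (e : W ≅ Z⟦(-1 : ℤ)⟧) :
    ∃ (q : W ⟶ X) (g' : Y ⟶ W⟦(1 : ℤ)⟧), Triangle.mk q f g' ∈ distTriang T := by
  let Δ := (Triangle.mk f g h).invRotate
  refine ⟨e.hom ≫ Δ.mor₁, Δ.mor₃ ≫ e.inv⟦(1 : ℤ)⟧',
    isomorphic_distinguished _ (inv_rot_of_distTriang _ hΔ) _
      (Triangle.isoMk _ _ e (Iso.refl _) (Iso.refl _) ?_ ?_ ?_)⟩
  · exact Category.comp_id _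
  · exact (Category.comp_id _).trans (Category.id_comp _).symm
  · have e_shift := ((shiftFunctor T (1 : ℤ)).mapIso e).inv_hom_id
    exact (Category.assoc _ _ _).trans ((congrArg (Δ.mor₃ ≫ ·) e_shift).trans
      ((Category.comp_id _).trans (Category.id_comp _).symm))

section Ghosts

open HomotopyCategory

variable {C : Type*} [Category* C] [Abelian C]

theorem exists_hom_to_injective_of_homology {F : CochainComplex C ℤ} (hd : ∀ i j, F.d i j = 0)
    (hF : ∀ s, Injective (F.X s)) (X : HomotopyCategory C (.up ℤ))
    (φ : ∀ s, (homologyFunctor C (.up ℤ) s).obj X ⟶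
      (homologyFunctor C (.up ℤ) s).obj ((quotient C (.up ℤ)).obj F)) :
    ∃ f : X ⟶ (quotient C (.up ℤ)).obj F, ∀ s, (homologyFunctor C (.up ℤ) s).map f = φ s := by
  obtain ⟨K, rfl⟩ := X.quotient_obj_surjective
  let e (s : ℤ) := homologyFunctorFactors C (.up ℤ) s
  obtain ⟨f, hf⟩ := AbelianCotorsion.exists_hom_of_homology_of_injective hd (Y := K)
    fun s => (e s).inv.app K ≫ φ s ≫ (e s).hom.app F
  refine ⟨(quotient C (.up ℤ)).map f, fun s => ?_⟩
  rw [← cancel_mono ((e s).hom.app F), ← cancel_epi ((e s).inv.app K)]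
  exact ((NatIso.naturality_1 (e s) f).trans (hf s) :)

theorem eq_zero_of_homologyFunctor_map_eq_zero_of_injective {F : CochainComplex C ℤ}
    (hd : ∀ i j, F.d i j = 0) (hF : ∀ s, Injective (F.X s)) {X : HomotopyCategory C (.up ℤ)}
    (f : X ⟶ (quotient C (.up ℤ)).obj F) (hf : ∀ s, (homologyFunctor C (.up ℤ) s).map f = 0) :
    f = 0 := by
  obtain ⟨K, rfl⟩ := X.quotient_obj_surjective
  obtain ⟨f, rfl⟩ := (quotient C (.up ℤ)).map_surjective f
  obtain ⟨H⟩ := AbelianCotorsion.nonempty_homotopy_zero_of_injective hd f fun s => by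
    let e := homologyFunctorFactors C (.up ℤ) s
    refine (NatIso.naturality_1 e f).symm.trans ?_
    rw [Functor.comp_map, hf, zero_comp]
    exact comp_zero
  rw [eq_of_homotopy _ _ H, Functor.map_zero]

theorem injective_homology_of_d_eq_zero {F : CochainComplex C ℤ} (hd : ∀ i j, F.d i j = 0)
    (hF : ∀ s, Injective (F.X s)) (s : ℤ) :
    Injective ((homologyFunctor C (.up ℤ) s).obj ((quotient C (.up ℤ)).obj F)) := by
  have := AbelianCotorsion.isIso_iCycles_of_d_eq_zero hd s
  have := AbelianCotorsion.isIso_homologyπ_of_d_eq_zero hd s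
  exact Injective.of_iso ((asIso (F.iCycles s)).symm ≪≫ asIso (F.homologyπ s) ≪≫
    ((homologyFunctorFactors C (.up ℤ) s).app F).symm) (hF s)

theorem shortExact_homologySequence {Δ : Triangle (HomotopyCategory C (.up ℤ))}
    (hΔ : Δ ∈ distTriang _) (h : ∀ s, (homologyFunctor C (.up ℤ) s).map Δ.mor₂ = 0) (s : ℤ) :
    ∃ (i : (homologyFunctor C (.up ℤ) (s - 1)).obj Δ.obj₃ ⟶
        (homologyFunctor C (.up ℤ) s).obj Δ.obj₁)
      (w : i ≫ (homologyFunctor C (.up ℤ) s).map Δ.mor₁ = 0),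
      (ShortComplex.mk i _ w).ShortExact := by
  let H := homologyFunctor C (.up ℤ) 0
  have hs : s - 1 + 1 = s := by lia
  exact ⟨H.homologySequenceδ Δ (s - 1) s hs, _,
    { exact := H.homologySequence_exact₁ Δ hΔ (s - 1) s hs
      mono_f := (H.homologySequence_exact₃ Δ hΔ (s - 1) s hs).mono_g (h (s - 1))
      epi_g := (H.homologySequence_exact₂ Δ hΔ s).epi_f (h s) }⟩

theorem exists_injective_fibre [EnoughInjectives C] (Y : HomotopyCategory C (.up ℤ)) :
    ∃ (F : CochainComplex C ℤ) (Y' : HomotopyCategory C (.up ℤ))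
      (q : (quotient C (.up ℤ)).obj F ⟶ Y') (p : Y' ⟶ Y), q ≫ p = 0 ∧
      (∀ i j, F.d i j = 0) ∧ (∀ s, Injective (F.X s)) ∧
      (∀ s, (homologyFunctor C (.up ℤ) s).map p = 0) ∧
      (∀ s, ∃ (i : (homologyFunctor C (.up ℤ) (s - 1)).obj Y ⟶ (homologyFunctor C (.up ℤ) s).obj _)
        (w : i ≫ (homologyFunctor C (.up ℤ) s).map q = 0), (ShortComplex.mk i _ w).ShortExact) ∧
      ∀ {P : HomotopyCategory C (.up ℤ)} (f : P ⟶ Y),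
        (∀ s, (homologyFunctor C (.up ℤ) s).map f = 0) → ∃ g : P ⟶ Y', g ≫ p = f := by
  obtain ⟨F, Y', p, i, δ, hΔ, hd, hF, hi⟩ := exists_triangle_to_injective Y
  obtain ⟨q, k, hT⟩ := exists_distinguished_of_iso_shift hΔ
    (((quotient C (.up ℤ)).commShiftIso (-1 : ℤ)).app F)
  have hp (s : ℤ) := homologyFunctor_map_mor₁_eq_zero hΔ (hi s)
  refine ⟨F⟦(-1 : ℤ)⟧, Y', q, p, comp_distTriang_mor_zero₁₂ _ hT, fun i j => ?_, fun s => hF _,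
    hp, fun s => shortExact_homologySequence hT hp s, fun f hf => ?_⟩
  · rw [CochainComplex.shiftFunctor_obj_d', hd, smul_zero]
    rfl
  · obtain ⟨g, hg⟩ := Triangle.coyoneda_exact₂ _ hΔ f
      (eq_zero_of_homologyFunctor_map_eq_zero_of_injective hd hF (f ≫ i)
        fun s => by rw [Functor.map_comp, hf, zero_comp])
    exact ⟨g, hg.symm⟩

variable [HasExt.{w} C] [EnoughInjectives C] {A B : ObjectProperty C}
  (h : AbelianCotorsion.IsCompleteHereditary A B)

include h

theorem exists_ghost_lift {Y : HomotopyCategory C (.up ℤ)}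
    (hY : ∀ s, B ((homologyFunctor C (.up ℤ) s).obj Y)) :
    ∃ (Y' : HomotopyCategory C (.up ℤ)) (p : Y' ⟶ Y),
      (∀ s, (homologyFunctor C (.up ℤ) s).map p = 0) ∧
      (∀ s, B ((homologyFunctor C (.up ℤ) s).obj Y')) ∧
      ∀ {P : HomotopyCategory C (.up ℤ)}, (∀ s, A ((homologyFunctor C (.up ℤ) s).obj P)) →
        ∀ f : P ⟶ Y, (∀ s, (homologyFunctor C (.up ℤ) s).map f = 0) →
          ∃ f' : P ⟶ Y', (∀ s, (homologyFunctor C (.up ℤ) s).map f' = 0) ∧ f' ≫ p = f := by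
  obtain ⟨F, Y', q, p, hqp, hd, hF, hp, hS, lift⟩ := exists_injective_fibre Y
  choose i w S using hS
  have hHF := injective_homology_of_d_eq_zero hd hF
  refine ⟨Y', p, hp, fun s => h.cokernel_mem _ (S s) (hY _) (h.mem_right_of_injective _),
    fun hP f hf => ?_⟩
  obtain ⟨g, rfl⟩ := lift f hf
  have exists_lift_homology (s : ℤ) := by
    have := h.subsingleton_ext (hP s) (hY (s - 1))
    exact AbelianCotorsion.exists_lift_of_subsingleton_ext (S s)
      ((homologyFunctor C (.up ℤ) s).map g)
  choose φ hφ using exists_lift_homology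
  obtain ⟨k, hk⟩ := exists_hom_to_injective_of_homology hd hF _ φ
  refine ⟨g - k ≫ q, fun s => ?_, by simp [hqp]⟩
  rw [Functor.map_sub, Functor.map_comp, hk, sub_eq_zero]
  exact (hφ s).symm

variable [HasProductsOfShape ℕ C] [HasExactLimitsOfShape (Discrete ℕ) C]

theorem eq_zero_of_homologyFunctor_map_eq_zero {P Y : HomotopyCategory C (.up ℤ)}
    (hP : (subcategoryAcyclic C).leftOrthogonal P)
    (hA : ∀ s, A ((homologyFunctor C (.up ℤ) s).obj P))
    (hB : ∀ s, B ((homologyFunctor C (.up ℤ) s).obj Y)) (f : P ⟶ Y)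
    (hf : ∀ s, (homologyFunctor C (.up ℤ) s).map f = 0) : f = 0 := by
  let Stage := {x : Σ Y : HomotopyCategory C (.up ℤ), (P ⟶ Y) //
    (∀ s, B ((homologyFunctor C (.up ℤ) s).obj x.1)) ∧
      ∀ s, (homologyFunctor C (.up ℤ) s).map x.2 = 0}
  have next (x : Stage) : ∃ (y : Stage) (p : y.1.1 ⟶ x.1.1),
      (∀ s, (homologyFunctor C (.up ℤ) s).map p = 0) ∧ y.1.2 ≫ p = x.1.2 := by
    obtain ⟨Y', p, hp, hY', lift⟩ := exists_ghost_lift h x.2.1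
    obtain ⟨f', hf', comm⟩ := lift hA x.1.2 x.2.2
    exact ⟨⟨⟨Y', f'⟩, hY', hf'⟩, p, hp, comm⟩
  choose succ p hp comm using next
  let x (n : ℕ) : Stage := n.rec ⟨⟨Y, f⟩, hB, hf⟩ fun _ => succ
  let g : P ⟶ ∏ᶜ fun n => (x n).1.1 := Pi.lift fun n => (x n).1.2
  have g_comp : g ≫ towerDiff (fun n => p (x n)) = 0 ≫ towerDiff (fun n => p (x n)) := by
    refine Pi.hom_ext _ _ fun n => ?_
    simp [g, Preadditive.comp_sub, comm, x]
  rw [← ObjectProperty.isColocal_trW] at hP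
  have g_eq_zero : g = 0 :=
    (hP _ (trW_subcategoryAcyclic_towerDiff fun n => hp (x n))).injective g_comp
  simpa [g, x] using congrArg (· ≫ Pi.π _ 0) g_eq_zero

end Ghosts

end RelTriangulated

/-! ### Cycles and boundaries -/

namespace AbelianCotorsion

section Boundaries

variable {C : Type*} [Category* C] [Abelian C] (K : CochainComplex C ℤ) (s : ℤ)

/-- The differential `Kˢ → Kˢ⁺¹` as a map onto the object of boundaries, the kernel of the map from
cycles to cohomology. -/
def toBoundaries : K.X s ⟶ kernel (K.homologyπ (s + 1)) :=
  kernel.lift _ (K.toCycles s (s + 1)) (by simp)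

@[simp]
theorem toBoundaries_ι : toBoundaries K s ≫ kernel.ι (K.homologyπ (s + 1)) = K.toCycles s (s + 1) :=
  kernel.lift_ι _ _ _

theorem iCycles_toBoundaries : K.iCycles s ≫ toBoundaries K s = 0 := by
  simp [← cancel_mono (kernel.ι (K.homologyπ (s + 1))), ← cancel_mono (K.iCycles (s + 1))]

theorem shortExact_boundaries_cycles :
    (ShortComplex.mk (kernel.ι (K.homologyπ s)) (K.homologyπ s) (by simp)).ShortExact :=
  .mk (ShortComplex.exact_kernel _)

theorem shortExact_cycles_boundaries :
    (ShortComplex.mk (K.iCycles s) (toBoundaries K s) (iCycles_toBoundaries K s)).ShortExact := by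
  have hK : (ShortComplex.mk (K.toCycles s (s + 1)) (K.homologyπ (s + 1)) (by simp)).Exact :=
    ShortComplex.exact_of_g_is_cokernel _
      (K.homologyIsCokernel s (s + 1) ((ComplexShape.up ℤ).prev_eq' rfl))
  have : Epi (toBoundaries K s) := hK.epi_kernelLift
  refine .mk (ShortComplex.exact_of_f_is_kernel _ ?_)
  refine KernelFork.IsLimit.ofι' _ _ fun {Z} k hk =>
    ⟨K.liftCycles k (s + 1) (by simp) ?_, K.liftCycles_i _ _ _ _⟩
  dsimp at hk
  rw [← K.toCycles_i s (s + 1), ← toBoundaries_ι, Category.assoc, reassoc_of% hk, zero_comp]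

/-- The differential `Kˢ → Kˢ⁺¹` as a monomorphism from the object of boundaries, here the cokernel
of the map from cohomology to the cokernel of the previous differential. -/
def fromCoboundaries : cokernel (K.homologyι s) ⟶ K.X (s + 1) :=
  cokernel.desc _ (K.fromOpcycles s (s + 1)) (by simp)

@[simp]
theorem π_fromCoboundaries :
    cokernel.π (K.homologyι s) ≫ fromCoboundaries K s = K.fromOpcycles s (s + 1) :=
  cokernel.π_desc _ _ _

theorem fromCoboundaries_pOpcycles : fromCoboundaries K s ≫ K.pOpcycles (s + 1) = 0 := by
  rw [← cancel_epi (cokernel.π (K.homologyι s)), ← cancel_epi (K.pOpcycles s), ← Category.assoc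
    (cokernel.π _), π_fromCoboundaries]
  simp

theorem shortExact_homology_opcycles :
    (ShortComplex.mk (K.homologyι s) (cokernel.π (K.homologyι s)) (by simp)).ShortExact :=
  .mk (ShortComplex.exact_cokernel _)

theorem shortExact_coboundaries_opcycles :
    (ShortComplex.mk (fromCoboundaries K s) (K.pOpcycles (s + 1))
      (fromCoboundaries_pOpcycles K s)).ShortExact := by
  have hK : (ShortComplex.mk (K.homologyι s) (K.fromOpcycles s (s + 1)) (by simp)).Exact :=
    ShortComplex.exact_of_f_is_kernel _
      (K.homologyIsKernel s (s + 1) ((ComplexShape.up ℤ).next_eq' rfl))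
  have : Mono (fromCoboundaries K s) := hK.mono_cokernelDesc
  refine .mk (ShortComplex.exact_of_g_is_cokernel _ ?_)
  refine CokernelCofork.IsColimit.ofπ' _ _ fun {Z} k hk =>
    ⟨K.descOpcycles k s (by simp) ?_, K.p_descOpcycles _ _ _ _⟩
  dsimp at hk
  rw [← K.p_fromOpcycles s (s + 1), ← π_fromCoboundaries, Category.assoc, Category.assoc, hk,
    comp_zero, comp_zero]

end Boundaries

namespace IsCompleteHereditary

variable {C : Type*} [Category* C] [Abelian C] [HasExt.{w} C] {A B : ObjectProperty C}
  (h : IsCompleteHereditary A B)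

include h

theorem homology_mem_of_opcycles_mem {P : CochainComplex C ℤ} [∀ s, Projective (P.X s)]
    (hA : ∀ s, A (P.opcycles s)) (s : ℤ) : A (P.homology s) :=
  h.kernel_mem _ (shortExact_homology_opcycles P s) (hA s)
    (h.kernel_mem _ (shortExact_coboundaries_opcycles P s) (h.mem_left_of_projective _) (hA _))

theorem homology_mem_of_cycles_mem {I : CochainComplex C ℤ} [∀ s, Injective (I.X s)]
    (hB : ∀ s, B (I.cycles s)) (s : ℤ) : B (I.homology s) := by
  obtain ⟨s, rfl⟩ : ∃ t, s = t + 1 := ⟨s - 1, by simp⟩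
  exact h.cokernel_mem _ (shortExact_boundaries_cycles I (s + 1))
    (h.cokernel_mem _ (shortExact_cycles_boundaries I s) (hB _) (h.mem_right_of_injective _)) (hB _)

theorem homology_single_mem_right {Y : C} (hY : B Y) (t s : ℤ) :
    B (((HomologicalComplex.single C (.up ℤ) t).obj Y).homology s) := by
  have := h.isClosedUnderIsomorphisms_right
  by_cases hs : s = t
  · subst hs
    exact B.prop_of_iso (HomologicalComplex.singleObjHomologySelfIso _ _ _).symm hY
  · have : Injective (((HomologicalComplex.single C (.up ℤ) t).obj Y).homology s) :=
      (HomologicalComplex.isZero_single_obj_homology _ _ _ _ hs).injective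
    exact h.mem_right_of_injective _

section

variable [EnoughInjectives C] [HasProductsOfShape ℕ C] [HasExactLimitsOfShape (Discrete ℕ) C]

theorem nonempty_homotopy_zero_of_homologyMap_eq_zero {P Y : CochainComplex C ℤ}
    (hP : P.IsKProjective) (hA : ∀ s, A (P.homology s)) (hB : ∀ s, B (Y.homology s)) (f : P ⟶ Y)
    (hf : ∀ s, HomologicalComplex.homologyMap f s = 0) : Nonempty (Homotopy f 0) := by
  have := h.isClosedUnderIsomorphisms_left
  have := h.isClosedUnderIsomorphisms_right
  let e (s : ℤ) := HomotopyCategory.homologyFunctorFactors C (.up ℤ) s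
  refine ⟨HomotopyCategory.homotopyOfEq _ _ ?_⟩
  rw [Functor.map_zero]
  refine RelTriangulated.eq_zero_of_homologyFunctor_map_eq_zero h
    (CochainComplex.IsKProjective.leftOrthogonal P)
    (fun s => A.prop_of_iso ((e s).app P).symm (hA s))
    (fun s => B.prop_of_iso ((e s).app Y).symm (hB s)) _ fun s => ?_
  refine (NatIso.naturality_2 (e s) f).symm.trans ?_
  rw [show (HomologicalComplex.homologyFunctor C (.up ℤ) s).map f = 0 from hf s, zero_comp,
    comp_zero]

theorem exists_d_comp_eq {P : CochainComplex C ℤ} (hP : P.IsKProjective)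
    (hA : ∀ s, A (P.homology s)) {Y : C} (hY : B Y) {s t : ℤ} (hst : s + 1 = t) (g : P.X s ⟶ Y)
    (hg : P.iCycles s ≫ g = 0) : ∃ ψ : P.X t ⟶ Y, P.d s t ≫ ψ = g := by
  have d_comp_g (i : ℤ) (_ : (ComplexShape.up ℤ).Rel i s) : P.d i s ≫ g = 0 := by
    rw [← P.toCycles_i, Category.assoc, hg, comp_zero]
  let f := HomologicalComplex.mkHomToSingle g d_comp_g
  have hf : HomologicalComplex.cyclesMap f s = 0 := by
    rw [← cancel_mono (HomologicalComplex.iCycles _ s), HomologicalComplex.cyclesMap_i, zero_comp,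
      HomologicalComplex.mkHomToSingle_f, reassoc_of% hg, zero_comp]
  obtain ⟨H⟩ := h.nonempty_homotopy_zero_of_homologyMap_eq_zero hP hA
    (h.homology_single_mem_right hY s) f fun i => by
      by_cases hi : i = s
      · subst hi
        rw [← cancel_epi (P.homologyπ i), HomologicalComplex.homologyπ_naturality, hf, zero_comp,
          comp_zero]
      · exact (HomologicalComplex.isZero_single_obj_homology _ _ _ _ hi).eq_of_tgt _ _
  refine ⟨H.hom t s ≫ (HomologicalComplex.singleObjXSelf (.up ℤ) s Y).hom, ?_⟩
  have d_comp_H : g ≫ (HomologicalComplex.singleObjXSelf (.up ℤ) s Y).inv =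
      P.d s t ≫ H.hom t s := by
    rw [← HomologicalComplex.mkHomToSingle_f g d_comp_g, H.comm s, dNext_eq _ hst,
      prevD_eq _ (show (ComplexShape.up ℤ).Rel (s - 1) s by simp), HomologicalComplex.single_obj_d,
      comp_zero, add_zero, HomologicalComplex.zero_f, add_zero]
  rw [← reassoc_of% d_comp_H, Iso.inv_hom_id, Category.comp_id]

theorem opcycles_mem_of_isKProjective {P : CochainComplex C ℤ} (hP : P.IsKProjective)
    (hPX : ∀ s, Projective (P.X s)) (hA : ∀ s, A (P.homology s)) (s : ℤ) : A (P.opcycles s) := by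
  obtain ⟨s, rfl⟩ : ∃ t, s = t + 1 := ⟨s - 1, by simp⟩
  rw [← h.left_eq]
  intro Y hY
  have : Subsingleton (Abelian.Ext (P.X (s + 1)) Y 1) :=
    Abelian.Ext.subsingleton_of_projective _ Y 0
  refine subsingleton_ext_of_exists_extension (shortExact_coboundaries_opcycles P s) fun φ => ?_
  obtain ⟨ψ, hψ⟩ := h.exists_d_comp_eq hP hA hY rfl (P.pOpcycles s ≫ cokernel.π (P.homologyι s) ≫ φ)
    (by rw [← P.homology_π_ι_assoc, cokernel.condition_assoc, zero_comp, comp_zero])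
  refine ⟨ψ, ?_⟩
  rw [← cancel_epi (cokernel.π (P.homologyι s)), ← cancel_epi (P.pOpcycles s), ← hψ,
    ← P.p_fromOpcycles s (s + 1), ← π_fromCoboundaries]
  simp only [Category.assoc]

end

open RelTriangulated in
theorem cycles_mem_of_isKInjective [EnoughProjectives C] [EnoughInjectives C]
    [HasCoproductsOfShape ℕ C] [HasExactColimitsOfShape (Discrete ℕ) C] [HasExt.{w} Cᵒᵖ]
    {I : CochainComplex C ℤ} (hI : I.IsKInjective) (hIX : ∀ s, Injective (I.X s))
    (hB : ∀ s, B (I.homology s)) (s : ℤ) : B (I.cycles s) := by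
  have := h.isClosedUnderIsomorphisms_right
  have := hasExactLimitsOfShape_discrete_op (C := C) (J := ℕ)
  obtain ⟨s, rfl⟩ := neg_surjective s
  obtain ⟨e⟩ := nonempty_opcycles_opComplex_iso I s
  have h_opcycles : B.op ((opComplex I).opcycles s) :=
    h.op.opcycles_mem_of_isKProjective (isKProjective_opComplex hI)
      (fun n => inferInstanceAs (Projective (Opposite.op (I.X (-n))))) (fun n => ?_) s
  · exact B.prop_of_iso e.symm.unop h_opcycles
  · obtain ⟨e⟩ := nonempty_homology_opComplex_iso I n
    exact B.prop_of_iso e.unop (hB (-n))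

end IsCompleteHereditary

end AbelianCotorsion

/-! ### Special preenvelopes of complexes -/

namespace AbelianCotorsion

section CycleDecomposition

variable {C : Type*} [Category* C] [Abelian C]

/-- A presentation of the complex `K` by short exact sequences `0 → Bˢ → Zˢ → Hˢ → 0` and
`0 → Zˢ → Kˢ → Bˢ⁺¹ → 0`, through which cohomology is computed. -/
structure CycleDecomposition (K : CochainComplex C ℤ) where
  B : ℤ → C
  Z : ℤ → C
  H : ℤ → C
  b (s : ℤ) : B s ⟶ Z s
  π (s : ℤ) : Z s ⟶ H s
  ι (s : ℤ) : Z s ⟶ K.X s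
  q (s : ℤ) : K.X s ⟶ B (s + 1)
  b_π (s : ℤ) : b s ≫ π s = 0
  ι_q (s : ℤ) : ι s ≫ q s = 0
  shortExact_b_π (s : ℤ) : (ShortComplex.mk (b s) (π s) (b_π s)).ShortExact
  shortExact_ι_q (s : ℤ) : (ShortComplex.mk (ι s) (q s) (ι_q s)).ShortExact
  d_eq (s : ℤ) : K.d s (s + 1) = q s ≫ b (s + 1) ≫ ι (s + 1)

namespace CycleDecomposition

variable {K : CochainComplex C ℤ} (D : CycleDecomposition K) (s : ℤ)

instance : Mono (D.b s) := (D.shortExact_b_π s).mono_f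

instance : Mono (D.ι s) := (D.shortExact_ι_q s).mono_f

instance : Epi (D.q s) := (D.shortExact_ι_q s).epi_g

def cyclesIso : K.cycles s ≅ D.Z s :=
  (K.cyclesIsKernel s (s + 1) (by simp)).conePointUniqueUpToIso
    (isKernelCompMono (D.shortExact_ι_q s).fIsKernel (D.b _ ≫ D.ι _) (D.d_eq s))

theorem cyclesIso_hom_ι : (D.cyclesIso s).hom ≫ D.ι s = K.iCycles s :=
  IsLimit.conePointUniqueUpToIso_hom_comp _ _ WalkingParallelPair.zero

theorem toCycles_cyclesIso_hom :
    K.toCycles s (s + 1) ≫ (D.cyclesIso (s + 1)).hom = D.q s ≫ D.b (s + 1) := by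
  rw [← cancel_mono (D.ι (s + 1)), Category.assoc, cyclesIso_hom_ι, K.toCycles_i, D.d_eq,
    Category.assoc]

theorem exists_homology_iso :
    ∃ e : K.homology s ≅ D.H s, K.homologyπ s ≫ e.hom = (D.cyclesIso s).hom ≫ D.π s := by
  obtain ⟨s, rfl⟩ : ∃ t, s = t + 1 := ⟨s - 1, by simp⟩
  have hK := K.homologyIsCokernel s (s + 1) (by simp)
  have hD := isCokernelEpiComp (D.shortExact_b_π (s + 1)).gIsCokernel (D.q s) rfl
  let α : Arrow.mk (K.toCycles s (s + 1)) ≅ Arrow.mk (D.q s ≫ D.b (s + 1)) :=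
    Arrow.isoMk' _ _ (Iso.refl _) (D.cyclesIso (s + 1)) (by
      rw [toCycles_cyclesIso_hom, Iso.refl_hom, Category.id_comp])
  exact ⟨CokernelCofork.mapIsoOfIsColimit hK hD α,
    CokernelCofork.π_mapOfIsColimit hK _ α.hom⟩

end CycleDecomposition

end CycleDecomposition

/-- A special `B`-preenvelope relative to `A`: a monomorphism to an object of `B` with cokernel
in `A`. -/
structure IsSpecialPreenvelope {C : Type*} [Category* C] [Abelian C] (A B : ObjectProperty C)
    {X Y : C} (f : X ⟶ Y) : Prop where
  mono : Mono f
  mem : B Y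
  cokernel_mem : A (cokernel f)

theorem IsSpecialPreenvelope.of_arrow_iso {C : Type*} [Category* C] [Abelian C]
    {A B : ObjectProperty C} [A.IsClosedUnderIsomorphisms] [B.IsClosedUnderIsomorphisms]
    {X X' Y Y' : C} {f : X ⟶ Y} (hf : IsSpecialPreenvelope A B f) {f' : X' ⟶ Y'} (e : X ≅ X')
    (e' : Y ≅ Y') (w : f ≫ e'.hom = e.hom ≫ f') : IsSpecialPreenvelope A B f' where
  mono := by
    have := hf.mono
    have factorisation : f' = e.inv ≫ f ≫ e'.hom := (Iso.eq_inv_comp e).2 w.symm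
    rw [factorisation]
    infer_instance
  mem := B.prop_of_iso e' hf.mem
  cokernel_mem := A.prop_of_iso (cokernel.mapIso f f' e e' w) hf.cokernel_mem

theorem shortExact_pullback {C : Type*} [Category* C] [Abelian C] {S : ShortComplex C}
    (hS : S.ShortExact) {X : C} (c : X ⟶ S.X₃) :
    (ShortComplex.mk (pullback.lift S.f 0 (by rw [S.zero, zero_comp])) (pullback.snd S.g c)
      (pullback.lift_snd _ _ _)).ShortExact := by
  have := hS.mono_f
  have := hS.epi_g
  have hf := pullback.lift_fst (f := S.g) (g := c) S.f 0 (by rw [S.zero, zero_comp])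
  have : Mono (pullback.lift (f := S.g) (g := c) S.f 0 (by rw [S.zero, zero_comp])) :=
    mono_of_mono_fac hf
  refine .mk (ShortComplex.exact_of_f_is_kernel _ (KernelFork.IsLimit.ofι' _ _ fun {Z} k hk =>
    ⟨hS.exact.lift (k ≫ pullback.fst S.g c) ?_, pullback.hom_ext ?_ ?_⟩))
  · rw [Category.assoc, pullback.condition, reassoc_of% hk, zero_comp]
  · rw [Category.assoc, pullback.lift_fst, hS.exact.lift_f]
  · rw [Category.assoc, pullback.lift_snd, comp_zero]
    exact hk.symm

namespace IsCompleteHereditary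

variable {C : Type*} [Category* C] [Abelian C] [HasExt.{w} C] {A B : ObjectProperty C}
  (h : IsCompleteHereditary A B)

include h

theorem exists_isSpecialPreenvelope (X : C) :
    ∃ (Y : C) (f : X ⟶ Y), IsSpecialPreenvelope A B f := by
  obtain ⟨Y, X', f, p, w, hY, hX', hS⟩ := h.exists_preenvelope X
  have := h.isClosedUnderIsomorphisms_left
  exact ⟨Y, f, hS.mono_f, hY, A.prop_of_iso
    (hS.gIsCokernel.coconePointUniqueUpToIso (colimit.isColimit _)) hX'⟩

theorem exists_extension {X Y : C} {f : X ⟶ Y} (hf : IsSpecialPreenvelope A B f) {W : C} (hW : B W)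
    (φ : X ⟶ W) : ∃ ψ : Y ⟶ W, f ≫ ψ = φ := by
  have := hf.mono
  have := h.subsingleton_ext hf.cokernel_mem hW
  exact exists_extension_of_subsingleton_ext
    (.mk (ShortComplex.exact_cokernel f) : (ShortComplex.mk f _ _).ShortExact) φ

variable [EnoughInjectives C]

theorem exists_horseshoe {S : ShortComplex C} (hS : S.ShortExact) {Y₁ Y₃ : C} (i₁ : S.X₁ ⟶ Y₁)
    (hY₁ : B Y₁) {i₃ : S.X₃ ⟶ Y₃} (hi₃ : IsSpecialPreenvelope A B i₃) :
    ∃ (Y₂ : C) (f : Y₁ ⟶ Y₂) (g : Y₂ ⟶ Y₃) (i₂ : S.X₂ ⟶ Y₂) (w : f ≫ g = 0),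
      (ShortComplex.mk f g w).ShortExact ∧ S.f ≫ i₂ = i₁ ≫ f ∧ i₂ ≫ g = S.g ≫ i₃ := by
  have := hS.mono_f
  have := hS.epi_g
  let T := ShortComplex.mk (Injective.ι Y₁) (cokernel.π _) (cokernel.condition _)
  have hT : T.ShortExact := .mk (ShortComplex.exact_cokernel _)
  have hT₃ : B T.X₃ := h.cokernel_mem _ hT hY₁ (h.mem_right_of_injective (Injective.under Y₁))
  obtain ⟨e, he⟩ : ∃ e : S.X₂ ⟶ T.X₂, S.f ≫ e = i₁ ≫ T.f :=
    ⟨Injective.factorThru (J := Injective.under Y₁) (i₁ ≫ T.f) S.f, Injective.comp_factorThru _ _⟩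
  have f_comp : S.f ≫ e ≫ T.g = 0 := by rw [reassoc_of% he, T.zero, comp_zero]
  obtain ⟨c, hc⟩ := h.exists_extension hi₃ hT₃ (hS.exact.desc (e ≫ T.g) f_comp)
  refine ⟨pullback T.g c, _, _, pullback.lift e (S.g ≫ i₃) ?_, _, shortExact_pullback hT c,
    pullback.hom_ext ?_ ?_, pullback.lift_snd _ _ _⟩
  · rw [Category.assoc, hc, hS.exact.g_desc]
  · rw [Category.assoc, pullback.lift_fst, Category.assoc, pullback.lift_fst, he]
  · rw [Category.assoc, pullback.lift_snd, Category.assoc, pullback.lift_snd, S.zero_assoc,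
      zero_comp, comp_zero]

theorem exists_cycleDecomposition (K : CochainComplex C ℤ) :
    ∃ (L : CochainComplex C ℤ) (D : CycleDecomposition L) (f : K ⟶ L)
      (z : ∀ s, K.cycles s ⟶ D.Z s) (η : ∀ s, K.homology s ⟶ D.H s),
      ∀ s, z s ≫ D.ι s = K.iCycles s ≫ f.f s ∧ z s ≫ D.π s = K.homologyπ s ≫ η s ∧
        IsSpecialPreenvelope A B (η s) := by
  choose B' iB hB using fun s => h.exists_isSpecialPreenvelope (kernel (K.homologyπ s))
  choose H iH hH using fun s => h.exists_isSpecialPreenvelope (K.homology s)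
  choose Z b π iZ b_π hbπ iB_b iZ_π using fun s =>
    h.exists_horseshoe (shortExact_boundaries_cycles K s) (iB s) (hB s).mem (hH s)
  have hZ (s : ℤ) : B (Z s) := h.extension_mem_right (hbπ s) (hB s).mem (hH s).mem
  choose Y ι q f ι_q hιq iZ_ι f_q using fun s =>
    h.exists_horseshoe (shortExact_cycles_boundaries K s) (iZ s) (hZ s) (hB (s + 1))
  let d (s : ℤ) : Y s ⟶ Y (s + 1) := q s ≫ b (s + 1) ≫ ι (s + 1)
  have hd (s : ℤ) : d s ≫ d (s + 1) = 0 := by simp [d, reassoc_of% (ι_q (s + 1))]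
  let L : CochainComplex C ℤ := CochainComplex.of Y d hd
  have hL (s : ℤ) : L.d s (s + 1) = d s := CochainComplex.of_d ..
  let D : CycleDecomposition L :=
    { B := B', Z := Z, H := H, b := b, π := π, ι := ι, q := q, b_π := b_π, ι_q := ι_q
      shortExact_b_π := hbπ, shortExact_ι_q := hιq, d_eq := hL }
  refine ⟨L, D, { f := f, comm' := ?_ }, iZ, iH, fun s => ⟨(iZ_ι s).symm, iZ_π s, hH s⟩⟩
  rintro i j (rfl : i + 1 = j)
  have boundary_comp : kernel.ι (K.homologyπ (i + 1)) ≫ iZ (i + 1) = iB (i + 1) ≫ b (i + 1) :=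
    iB_b (i + 1)
  have cycle_comp : K.iCycles (i + 1) ≫ f (i + 1) = iZ (i + 1) ≫ ι (i + 1) := iZ_ι (i + 1)
  have d_comp : f i ≫ q i = toBoundaries K i ≫ iB (i + 1) := f_q i
  rw [hL, ← K.toCycles_i i (i + 1), ← toBoundaries_ι, Category.assoc, Category.assoc, cycle_comp,
    reassoc_of% boundary_comp, reassoc_of% d_comp]

theorem exists_isSpecialPreenvelope_homologyMap (K : CochainComplex C ℤ) :
    ∃ (L : CochainComplex C ℤ) (f : K ⟶ L),
      ∀ s, IsSpecialPreenvelope A B (HomologicalComplex.homologyMap f s) := by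
  obtain ⟨L, D, f, z, η, hD⟩ := h.exists_cycleDecomposition K
  refine ⟨L, f, fun s => ?_⟩
  obtain ⟨hz, hη, special⟩ := hD s
  obtain ⟨e, he⟩ := D.exists_homology_iso s
  have := h.isClosedUnderIsomorphisms_left
  have := h.isClosedUnderIsomorphisms_right
  have cyclesMap_comp : HomologicalComplex.cyclesMap f s ≫ (D.cyclesIso s).hom = z s := by
    rw [← cancel_mono (D.ι s), Category.assoc, D.cyclesIso_hom_ι,
      HomologicalComplex.cyclesMap_i, hz]
  refine special.of_arrow_iso (Iso.refl _) e.symm ?_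
  rw [← cancel_epi (K.homologyπ s), ← reassoc_of% hη, Iso.refl_hom, Category.id_comp,
    HomologicalComplex.homologyπ_naturality, ← cyclesMap_comp, Category.assoc, ← reassoc_of% he,
    Iso.symm_hom, e.hom_inv_id, Category.comp_id]

end IsCompleteHereditary

end AbelianCotorsion

/-! ### Relative homological algebra for the cohomologically exact triangles -/

namespace RelTriangulated

section HomShortExact

variable {T : Type*} [Category* T] [Preadditive T] [HasZeroObject T] [HasShift T ℤ]
  [∀ n : ℤ, (shiftFunctor T n).Additive] [Pretriangulated T]

theorem homShortExact_iff {Δ : Triangle T} (hΔ : Δ ∈ distTriang T) (P : T) :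
    HomShortExact P Δ ↔ (∀ g : P ⟶ Δ.obj₁, g ≫ Δ.mor₁ = 0 → g = 0) ∧
      ∀ g : P ⟶ Δ.obj₃, ∃ f : P ⟶ Δ.obj₂, f ≫ Δ.mor₂ = g := by
  constructor
  · intro h
    exact ⟨fun g hg => (injective_iff_map_eq_zero _).1 h.injective g hg, fun g => h.surjective g⟩
  · rintro ⟨h₁, h₂⟩
    refine ⟨(injective_iff_map_eq_zero _).2 h₁, fun g => ⟨fun hg => ?_, ?_⟩, h₂⟩
    · obtain ⟨f, hf⟩ := Triangle.coyoneda_exact₂ Δ hΔ g hg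
      exact ⟨f, hf.symm⟩
    · rintro ⟨f, rfl⟩
      change (f ≫ Δ.mor₁) ≫ Δ.mor₂ = 0
      rw [Category.assoc, comp_distTriang_mor_zero₁₂ Δ hΔ, comp_zero]

theorem HomShortExact.of_retract {Δ : Triangle T} (hΔ : Δ ∈ distTriang T) {P P' : T}
    (h : HomShortExact P Δ) (r : Retract P' P) : HomShortExact P' Δ := by
  rw [homShortExact_iff hΔ] at h ⊢
  refine ⟨fun g hg => ?_, fun g => ?_⟩
  · have r_comp : r.r ≫ g = 0 := h.1 _ (by rw [Category.assoc, hg, comp_zero])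
    rw [← Category.id_comp g, ← r.retract, Category.assoc, r_comp, comp_zero]
  · obtain ⟨f, hf⟩ := h.2 (r.r ≫ g)
    exact ⟨r.i ≫ f, by rw [Category.assoc, hf, r.retract_assoc]⟩

theorem HomShortExact.of_isColimit {Δ : Triangle T} (hΔ : Δ ∈ distTriang T) {ι : Type*}
    {X : ι → T} {c : Cofan X} (hc : IsColimit c) (h : ∀ j, HomShortExact (X j) Δ) :
    HomShortExact c.pt Δ := by
  simp only [homShortExact_iff hΔ] at h ⊢
  refine ⟨fun g hg => ?_, fun g => ?_⟩
  · refine Cofan.IsColimit.hom_ext hc _ _ fun j => ?_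
    rw [comp_zero]
    exact (h j).1 _ (by rw [Category.assoc, hg, comp_zero])
  · choose f hf using fun j => (h j).2 (c.inj j ≫ g)
    refine ⟨Cofan.IsColimit.desc hc f, Cofan.IsColimit.hom_ext hc _ _ fun j => ?_⟩
    simp [hf]

end HomShortExact

theorem subsingleton_homCohomologySucc_iff {T : Type*} [Category* T] [Preadditive T] [HasShift T ℤ]
    {ξ : Set (Triangle T)} {X : T} (ρ : ProjResolution ξ X) (Y : T) :
    Subsingleton (ρ.HomCohomologySucc Y 0) ↔
      ∀ f : ρ.P 1 ⟶ Y, ρ.d 1 ≫ f = 0 → ∃ g : ρ.P 0 ⟶ Y, ρ.d 0 ≫ g = f := by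
  rw [QuotientAddGroup.subsingleton_iff, AddSubgroup.addSubgroupOf_eq_top]
  exact ⟨fun h f hf => h (show f ∈ (Preadditive.leftComp Y (ρ.d 1)).ker from hf),
    fun h f hf => h f hf⟩

open DerivedCategory

variable {C : Type*} [Category* C] [Abelian C] [HasDerivedCategory.{w} C]

def homologyQIso (K : CochainComplex C ℤ) (s : ℤ) :
    (homologyFunctor C s).obj (Q.obj K) ≅ K.homology s :=
  (homologyFunctorFactors C s).app K

theorem homologyQIso_hom_naturality {K L : CochainComplex C ℤ} (f : K ⟶ L) (s : ℤ) :
    (homologyFunctor C s).map (Q.map f) ≫ (homologyQIso L s).hom =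
      (homologyQIso K s).hom ≫ HomologicalComplex.homologyMap f s :=
  (homologyFunctorFactors C s).hom.naturality f

/-- Objects `P` with projective cohomology such that morphisms out of `P` are the same as
graded morphisms out of the cohomology of `P`. -/
structure IsFormalProjective (P : DerivedCategory C) : Prop where
  projective (s : ℤ) : Projective ((homologyFunctor C s).obj P)
  eq_zero {Y : DerivedCategory C} (g : P ⟶ Y) : (∀ s, (homologyFunctor C s).map g = 0) → g = 0
  exists_map {Y : DerivedCategory C}
    (φ : ∀ s, (homologyFunctor C s).obj P ⟶ (homologyFunctor C s).obj Y) :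
    ∃ g : P ⟶ Y, ∀ s, (homologyFunctor C s).map g = φ s

namespace IsFormalProjective

theorem of_retract {P P' : DerivedCategory C} (hP : IsFormalProjective P) (r : Retract P' P) :
    IsFormalProjective P' where
  projective s := by
    have := hP.projective s
    exact Retract.projective (r.map (homologyFunctor C s))
  eq_zero g hg := by
    have r_comp : r.r ≫ g = 0 := hP.eq_zero _ fun s => by rw [Functor.map_comp, hg, comp_zero]
    rw [← Category.id_comp g, ← r.retract, Category.assoc, r_comp, comp_zero]
  exists_map φ := by
    obtain ⟨g, hg⟩ := hP.exists_map fun s => (homologyFunctor C s).map r.r ≫ φ s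
    refine ⟨r.i ≫ g, fun s => ?_⟩
    rw [Functor.map_comp, hg, ← Functor.map_comp_assoc, r.retract, CategoryTheory.Functor.map_id,
      Category.id_comp]

theorem ext {P Y : DerivedCategory C} (hP : IsFormalProjective P) {g g' : P ⟶ Y}
    (h : ∀ s, (homologyFunctor C s).map g = (homologyFunctor C s).map g') : g = g' := by
  rw [← sub_eq_zero]
  exact hP.eq_zero _ fun s => by rw [Functor.map_sub, h, sub_self]

theorem exists_map_degree {P Y : DerivedCategory C} (hP : IsFormalProjective P) (s : ℤ)
    (φ : (homologyFunctor C s).obj P ⟶ (homologyFunctor C s).obj Y) :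
    ∃ g : P ⟶ Y, (homologyFunctor C s).map g = φ ∧
      ∀ j, j ≠ s → (homologyFunctor C j).map g = 0 := by
  obtain ⟨g, hg⟩ := hP.exists_map (Y := Y) fun j => if h : j = s then
    eqToHom (by rw [h]) ≫ φ ≫ eqToHom (by rw [h]) else 0
  exact ⟨g, by simp [hg s], fun j hj => by simp [hg j, hj]⟩

end IsFormalProjective

theorem isFormalProjective_Q_obj {F : CochainComplex C ℤ} (hF : ∀ i j, F.d i j = 0)
    [∀ s, Projective (F.X s)] : IsFormalProjective (Q.obj F) where
  projective s := by
    have := AbelianCotorsion.isIso_iCycles_of_d_eq_zero hF s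
    have := AbelianCotorsion.isIso_homologyπ_of_d_eq_zero hF s
    exact Projective.of_iso ((asIso (F.iCycles s)).symm ≪≫ asIso (F.homologyπ s) ≪≫
      (homologyQIso F s).symm) inferInstance
  eq_zero {Y} g hg := by
    let e := Q.objObjPreimageIso Y
    obtain ⟨L, f, s, hs, hfs⟩ := left_fac (g ≫ e.inv)
    have hf (n : ℤ) : HomologicalComplex.homologyMap f n = 0 := by
      have map_f : Q.map f = g ≫ e.inv ≫ Q.map s := by rw [← Category.assoc, hfs]; simp
      rw [← cancel_epi (homologyQIso F n).hom, ← homologyQIso_hom_naturality, map_f,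
        Functor.map_comp, hg, zero_comp, zero_comp, comp_zero]
    obtain ⟨hf₀⟩ := AbelianCotorsion.nonempty_homotopy_zero_of_projective hF f hf
    rw [Q_map_eq_of_homotopy _ hf₀, Functor.map_zero, zero_comp] at hfs
    rw [← cancel_mono e.inv, hfs, zero_comp]
  exists_map {Y} φ := by
    let e := Q.objObjPreimageIso Y
    obtain ⟨f, hf⟩ := AbelianCotorsion.exists_hom_of_homology_of_projective hF fun s =>
      (homologyQIso F s).inv ≫ φ s ≫ (homologyFunctor C s).map e.inv ≫ (homologyQIso _ s).hom
    refine ⟨Q.map f ≫ e.hom, fun s => ?_⟩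
    have map_f := homologyQIso_hom_naturality f s
    rw [hf, Iso.hom_inv_id_assoc, ← Category.assoc, cancel_mono] at map_f
    rw [Functor.map_comp, map_f, Category.assoc, ← Functor.map_comp, e.inv_hom_id,
      CategoryTheory.Functor.map_id, Category.comp_id]

theorem isFormalProjective_singleFunctor_obj (M : C) [Projective M] (n : ℤ) :
    IsFormalProjective ((singleFunctor C n).obj M) := by
  let F := (HomologicalComplex.single C (ComplexShape.up ℤ) n).obj M
  have (s : ℤ) : Projective (F.X s) := by
    by_cases h : s = n
    · subst h
      exact Projective.of_iso
        (HomologicalComplex.singleObjXSelf (ComplexShape.up ℤ) s M).symm inferInstance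
    · exact (HomologicalComplex.isZero_single_obj_X _ _ _ _ h).projective
  exact isFormalProjective_Q_obj (F := F) (HomologicalComplex.single_obj_d _ _ _)

variable (C) in
/-- The distinguished triangles inducing short exact sequences in cohomology. By the long exact
sequence it suffices to ask for epimorphisms onto the cohomology of the third object. -/
def cohExact : Set (Triangle (DerivedCategory C)) :=
  {Δ | Δ ∈ distTriang _ ∧ ∀ s, Epi ((homologyFunctor C s).map Δ.mor₂)}

theorem mem_cohExact_of_mono {Δ : Triangle (DerivedCategory C)} (hΔ : Δ ∈ distTriang _)
    (h : ∀ s, Mono ((homologyFunctor C s).map Δ.mor₁)) : Δ ∈ cohExact C := by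
  refine ⟨hΔ, fun s => ?_⟩
  rw [HomologySequence.epi_homologyMap_mor₂_iff Δ hΔ s (s + 1),
    ← HomologySequence.mono_homologyMap_mor₁_iff Δ hΔ s (s + 1)]
  exact h _

theorem shortExact_homology {Δ : Triangle (DerivedCategory C)} (hΔ : Δ ∈ cohExact C) (s : ℤ) :
    (ShortComplex.mk ((homologyFunctor C s).map Δ.mor₁) ((homologyFunctor C s).map Δ.mor₂)
      (by rw [← Functor.map_comp, comp_distTriang_mor_zero₁₂ _ hΔ.1,
        Functor.map_zero])).ShortExact := by
  have : Mono ((homologyFunctor C s).map Δ.mor₁) := by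
    rw [HomologySequence.mono_homologyMap_mor₁_iff Δ hΔ.1 (s - 1) s,
      ← HomologySequence.epi_homologyMap_mor₂_iff Δ hΔ.1 (s - 1) s]
    exact hΔ.2 _
  have := hΔ.2 s
  exact .mk (HomologySequence.exact₂ Δ hΔ.1 s)

theorem exists_shortExact_homology {X Y Z : DerivedCategory C} {f : X ⟶ Y} {g : Y ⟶ Z}
    {h : Z ⟶ X⟦(1 : ℤ)⟧} (hΔ : Triangle.mk f g h ∈ cohExact C) (s : ℤ) :
    ∃ w, (ShortComplex.mk ((homologyFunctor C s).map f)
      ((homologyFunctor C s).map g) w).ShortExact :=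
  ⟨_, shortExact_homology hΔ s⟩

theorem IsFormalProjective.isProjective {P : DerivedCategory C} (hP : IsFormalProjective P) :
    IsProjective (cohExact C) P := by
  intro Δ hΔ
  have (s : ℤ) : Mono ((homologyFunctor C s).map Δ.mor₁) := (shortExact_homology hΔ s).mono_f
  have := hΔ.2
  have := hP.projective
  rw [homShortExact_iff hΔ.1]
  refine ⟨fun g hg => hP.eq_zero _ fun s => ?_, fun g => ?_⟩
  · rw [← cancel_mono ((homologyFunctor C s).map Δ.mor₁), ← Functor.map_comp, hg,
      Functor.map_zero, zero_comp]
  · obtain ⟨f, hf⟩ := hP.exists_map fun s =>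
      Projective.factorThru ((homologyFunctor C s).map g) ((homologyFunctor C s).map Δ.mor₂)
    exact ⟨f, hP.ext fun s => by rw [Functor.map_comp, hf, Projective.factorThru_comp]⟩

namespace ProjResolution

variable {X Y : DerivedCategory C} (ρ : ProjResolution (cohExact C) X)

theorem d_comp_p (n : ℕ) : ρ.d (n + 1) ≫ ρ.p (n + 1) = 0 := by
  have i_p : ρ.i (n + 1) ≫ ρ.p (n + 1) = 0 := comp_distTriang_mor_zero₁₂ _ (ρ.mem _).1
  rw [d, Category.assoc, i_p, comp_zero]

theorem exists_homology_factorisation {f : ρ.P 1 ⟶ Y} (hf : ρ.d 1 ≫ f = 0) (s : ℤ) :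
    ∃ φ : (homologyFunctor C s).obj (ρ.K 1) ⟶ (homologyFunctor C s).obj Y,
      (homologyFunctor C s).map (ρ.p 1) ≫ φ = (homologyFunctor C s).map f := by
  obtain ⟨w₁, h₁⟩ := exists_shortExact_homology (ρ.mem 1) s
  obtain ⟨w₂, h₂⟩ := exists_shortExact_homology (ρ.mem 2) s
  have : Epi ((homologyFunctor C s).map (ρ.p 2)) := h₂.epi_g
  have i_f : (homologyFunctor C s).map (ρ.i 1) ≫ (homologyFunctor C s).map f = 0 := by
    rw [← cancel_epi ((homologyFunctor C s).map (ρ.p 2)), ← Functor.map_comp, ← Functor.map_comp,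
      comp_zero, ← Category.assoc]
    exact (congrArg _ hf).trans (Functor.map_zero _ _ _)
  have : Epi ((homologyFunctor C s).map (ρ.p 1)) := h₁.epi_g
  exact ⟨h₁.exact.desc _ i_f, h₁.exact.g_desc _ i_f⟩

end ProjResolution

section EnoughProjectives

variable [EnoughProjectives C]

theorem exists_formalProjective_cover (X : DerivedCategory C) :
    ∃ (K P : DerivedCategory C) (f : K ⟶ P) (g : P ⟶ X) (h : X ⟶ K⟦(1 : ℤ)⟧),
      IsFormalProjective P ∧ Triangle.mk f g h ∈ cohExact C := by
  let F := AbelianCotorsion.zeroDiff fun s => Projective.over ((homologyFunctor C s).obj X)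
  have hF : ∀ i j, F.d i j = 0 := fun _ _ => rfl
  have (s : ℤ) : Projective (F.X s) := Projective.projective_over ((homologyFunctor C s).obj X)
  have hP : IsFormalProjective (Q.obj F) := isFormalProjective_Q_obj hF
  have := AbelianCotorsion.isIso_iCycles_of_d_eq_zero hF
  have := AbelianCotorsion.isIso_homologyπ_of_d_eq_zero hF
  let π (s : ℤ) : F.X s ⟶ (homologyFunctor C s).obj X := Projective.π _
  have hπ (s : ℤ) : Epi (π s) := Projective.π_epi _
  obtain ⟨g, hg⟩ := hP.exists_map fun s => (homologyQIso F s).hom ≫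
    inv (F.homologyπ s) ≫ F.iCycles s ≫ π s
  obtain ⟨K, f, h, hΔ⟩ := distinguished_cocone_triangle₁ g
  have epi_g (s : ℤ) : Epi ((homologyFunctor C s).map g) := by
    rw [hg]
    infer_instance
  exact ⟨K, _, f, g, h, hP, hΔ, epi_g⟩

theorem isProjective_cohExact_iff {P : DerivedCategory C} :
    IsProjective (cohExact C) P ↔ IsFormalProjective P := by
  refine ⟨fun hP => ?_, fun hP => hP.isProjective⟩
  obtain ⟨K, P', f, g, h, hP', hΔ⟩ := exists_formalProjective_cover P
  obtain ⟨i, hi⟩ := (hP _ hΔ).surjective (𝟙 P)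
  exact hP'.of_retract { i := i, r := g, retract := hi }

theorem nonempty_projResolution (X : DerivedCategory C) :
    Nonempty (ProjResolution (cohExact C) X) := by
  choose K P f g h hP hΔ using exists_formalProjective_cover (C := C)
  let L : ℕ → DerivedCategory C := Nat.rec X fun _ => K
  exact ⟨{
    K := L
    P n := P (L n)
    i n := f (L n)
    p n := g (L n)
    δ n := h (L n)
    mem n := hΔ (L n)
    projective n := (hP (L n)).isProjective
    iso := Iso.refl _ }⟩

namespace ProjResolution

variable {X Y : DerivedCategory C} (ρ : ProjResolution (cohExact C) X)

theorem isFormalProjective (n : ℕ) : IsFormalProjective (ρ.P n) :=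
  isProjective_cohExact_iff.1 (ρ.projective n)

theorem exists_cocycle (s : ℤ)
    (φ : (homologyFunctor C s).obj (ρ.K 1) ⟶ (homologyFunctor C s).obj Y) :
    ∃ f : ρ.P 1 ⟶ Y, ρ.d 1 ≫ f = 0 ∧
      (homologyFunctor C s).map f = (homologyFunctor C s).map (ρ.p 1) ≫ φ := by
  obtain ⟨f, hf, hf'⟩ := (ρ.isFormalProjective 1).exists_map_degree s
    ((homologyFunctor C s).map (ρ.p 1) ≫ φ)
  refine ⟨f, (ρ.isFormalProjective 2).eq_zero _ fun j => ?_, hf⟩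
  by_cases hj : j = s
  · subst hj
    rw [Functor.map_comp, hf, ← Functor.map_comp_assoc, ρ.d_comp_p, Functor.map_zero, zero_comp]
  · rw [Functor.map_comp, hf' j hj, comp_zero]

end ProjResolution

variable [HasExt.{u} C]

theorem XiExtOneVanishes.subsingleton_ext {X Y : DerivedCategory C}
    (h : XiExtOneVanishes (cohExact C) X Y) (s : ℤ) :
    Subsingleton (Abelian.Ext ((homologyFunctor C s).obj X) ((homologyFunctor C s).obj Y) 1) := by
  obtain ⟨ρ⟩ := nonempty_projResolution X
  obtain ⟨w₀, h₀⟩ := exists_shortExact_homology (ρ.mem 0) s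
  obtain ⟨w₁, h₁⟩ := exists_shortExact_homology (ρ.mem 1) s
  have : Epi ((homologyFunctor C s).map (ρ.p 1)) := h₁.epi_g
  have := (ρ.isFormalProjective 0).projective s
  have : Subsingleton (Abelian.Ext ((homologyFunctor C s).obj (ρ.P 0))
      ((homologyFunctor C s).obj Y) 1) := Abelian.Ext.subsingleton_of_projective _ _ 0
  have : Subsingleton (Abelian.Ext ((homologyFunctor C s).obj (ρ.K 0))
      ((homologyFunctor C s).obj Y) 1) := by
    refine AbelianCotorsion.subsingleton_ext_of_exists_extension h₀ fun φ => ?_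
    obtain ⟨f, hf, map_f⟩ := ρ.exists_cocycle s φ
    obtain ⟨g, hg⟩ := (subsingleton_homCohomologySucc_iff ρ Y).1 (h ρ) f hf
    refine ⟨(homologyFunctor C s).map g, ?_⟩
    rw [← cancel_epi ((homologyFunctor C s).map (ρ.p 1)), ← map_f, ← hg, ProjResolution.d,
      Functor.map_comp, Functor.map_comp, Category.assoc]
  exact AbelianCotorsion.subsingleton_ext_of_iso ((homologyFunctor C s).mapIso ρ.iso) (Iso.refl _)

theorem xiExtOneVanishes_of_subsingleton_ext {X Y : DerivedCategory C}
    (h : ∀ s, Subsingleton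
      (Abelian.Ext ((homologyFunctor C s).obj X) ((homologyFunctor C s).obj Y) 1)) :
    XiExtOneVanishes (cohExact C) X Y := by
  refine fun ρ => (subsingleton_homCohomologySucc_iff ρ Y).2 fun f hf => ?_
  have lift (s : ℤ) : ∃ ψ : (homologyFunctor C s).obj (ρ.P 0) ⟶ (homologyFunctor C s).obj Y,
      (homologyFunctor C s).map (ρ.d 0) ≫ ψ = (homologyFunctor C s).map f := by
    obtain ⟨w₀, h₀⟩ := exists_shortExact_homology (ρ.mem 0) s
    obtain ⟨φ, hφ⟩ := ρ.exists_homology_factorisation hf s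
    have := h s
    have : Subsingleton (Abelian.Ext ((homologyFunctor C s).obj (ρ.K 0))
        ((homologyFunctor C s).obj Y) 1) := AbelianCotorsion.subsingleton_ext_of_iso
      ((homologyFunctor C s).mapIso ρ.iso.symm) (Iso.refl _)
    obtain ⟨ψ, hψ⟩ := AbelianCotorsion.exists_extension_of_subsingleton_ext h₀ φ
    exact ⟨ψ, by rw [ProjResolution.d, Functor.map_comp, Category.assoc, ← hφ]; exact congrArg _ hψ⟩
  choose ψ hψ using lift
  obtain ⟨g, hg⟩ := (ρ.isFormalProjective 0).exists_map ψ
  exact ⟨g, (ρ.isFormalProjective 1).ext fun s => by rw [Functor.map_comp, hg, hψ]⟩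

theorem xiExtOneVanishes_iff (X Y : DerivedCategory C) :
    XiExtOneVanishes (cohExact C) X Y ↔ ∀ s, Subsingleton
      (Abelian.Ext ((homologyFunctor C s).obj X) ((homologyFunctor C s).obj Y) 1) :=
  ⟨fun h => h.subsingleton_ext, xiExtOneVanishes_of_subsingleton_ext⟩

end EnoughProjectives

end RelTriangulated

/-! ### Cotorsion pairs detected in cohomology -/

namespace RelTriangulated

open DerivedCategory ZeroObject

variable {C : Type*} [Category* C] [Abelian C] [HasDerivedCategory.{w} C]

section Single

def homologySingleIso (M : C) (s : ℤ) :
    (homologyFunctor C s).obj ((singleFunctor C s).obj M) ≅ M :=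
  homologyQIso ((HomologicalComplex.single _ _ s).obj M) s ≪≫
    (HomologicalComplex.homologyFunctorSingleIso _ (ComplexShape.up ℤ) s).app M

theorem homologySingleIso_hom_naturality {M N : C} (f : M ⟶ N) (s : ℤ) :
    (homologyFunctor C s).map ((singleFunctor C s).map f) ≫ (homologySingleIso N s).hom =
      (homologySingleIso M s).hom ≫ f := by
  have factor {K L : CochainComplex C ℤ} (φ : K ⟶ L) (a : K.homology s ⟶ M) (b : L.homology s ⟶ N)
      (h : HomologicalComplex.homologyMap φ s ≫ b = a ≫ f) :
      (homologyFunctor C s).map (Q.map φ) ≫ (homologyQIso L s).hom ≫ b =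
        ((homologyQIso K s).hom ≫ a) ≫ f := by
    rw [Category.assoc, ← h, ← Category.assoc, homologyQIso_hom_naturality, Category.assoc]
  exact factor ((HomologicalComplex.single C (ComplexShape.up ℤ) s).map f) _ _
    ((HomologicalComplex.homologyFunctorSingleIso C (ComplexShape.up ℤ) s).hom.naturality f)

theorem isZero_homology_single (M : C) {s j : ℤ} (h : j ≠ s) :
    IsZero ((homologyFunctor C j).obj ((singleFunctor C s).obj M)) :=
  (HomologicalComplex.isZero_single_obj_homology (ComplexShape.up ℤ) s M j h).of_iso
    (homologyQIso ((HomologicalComplex.single _ _ s).obj M) j)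

theorem singleTriangle_mem_cohExact {S : ShortComplex C} (hS : S.ShortExact) :
    hS.singleTriangle ∈ cohExact C := by
  refine ⟨hS.singleTriangle_distinguished, fun s => ?_⟩
  change Epi ((homologyFunctor C s).map ((singleFunctor C 0).map S.g))
  by_cases hs : s = 0
  · subst hs
    have := hS.epi_g
    have map_g : (homologyFunctor C 0).map ((singleFunctor C 0).map S.g) =
        (homologySingleIso S.X₂ 0).hom ≫ S.g ≫ (homologySingleIso S.X₃ 0).inv := by
      rw [← Category.assoc, ← homologySingleIso_hom_naturality, Category.assoc, Iso.hom_inv_id,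
        Category.comp_id]
    rw [map_g]
    infer_instance
  · exact (isZero_homology_single S.X₃ hs).epi _

variable [EnoughProjectives C] [HasExt.{u} C]

theorem xiExtOneVanishes_single_left_iff (M : C) (s : ℤ) (Y : DerivedCategory C) :
    XiExtOneVanishes (cohExact C) ((singleFunctor C s).obj M) Y ↔
      Subsingleton (Abelian.Ext M ((homologyFunctor C s).obj Y) 1) := by
  rw [xiExtOneVanishes_iff]
  refine ⟨fun h => ?_, fun h j => ?_⟩
  · have := h s
    exact AbelianCotorsion.subsingleton_ext_of_iso (homologySingleIso M s) (Iso.refl _)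
  · by_cases hj : j = s
    · subst hj
      exact AbelianCotorsion.subsingleton_ext_of_iso (homologySingleIso M j).symm (Iso.refl _)
    · have := (isZero_homology_single M hj).projective
      exact Abelian.Ext.subsingleton_of_projective _ _ 0

theorem xiExtOneVanishes_single_right_iff (X : DerivedCategory C) (M : C) (s : ℤ) :
    XiExtOneVanishes (cohExact C) X ((singleFunctor C s).obj M) ↔
      Subsingleton (Abelian.Ext ((homologyFunctor C s).obj X) M 1) := by
  rw [xiExtOneVanishes_iff]
  refine ⟨fun h => ?_, fun h j => ?_⟩
  · have := h s
    exact AbelianCotorsion.subsingleton_ext_of_iso (Iso.refl _) (homologySingleIso M s)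
  · by_cases hj : j = s
    · subst hj
      exact AbelianCotorsion.subsingleton_ext_of_iso (Iso.refl _) (homologySingleIso M j).symm
    · have := (isZero_homology_single M hj).injective
      exact Abelian.Ext.subsingleton_of_injective _ _ 0

end Single

/-- The objects of the derived category all of whose cohomology objects lie in `S`. -/
def cohLift (S : ObjectProperty C) : ObjectProperty (DerivedCategory C) :=
  fun X => ∀ s, S ((homologyFunctor C s).obj X)

theorem cohLift_single_iff {S : ObjectProperty C} [S.IsClosedUnderIsomorphisms] [S.ContainsZero]
    (M : C) (s : ℤ) : cohLift S ((singleFunctor C s).obj M) ↔ S M := by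
  refine ⟨fun h => S.prop_of_iso (homologySingleIso M s) (h s), fun h j => ?_⟩
  by_cases hj : j = s
  · subst hj
    exact S.prop_of_iso (homologySingleIso M j).symm h
  · exact S.prop_of_isZero (isZero_homology_single M hj)

theorem exists_cohExact_cobaseChange {K P X Y Z : DerivedCategory C} {i : K ⟶ P} {p : P ⟶ X}
    {δ : X ⟶ K⟦(1 : ℤ)⟧} (hi : Triangle.mk i p δ ∈ cohExact C) {u : Z ⟶ K} {f : K ⟶ Y}
    {v : Y ⟶ Z⟦(1 : ℤ)⟧} (hu : Triangle.mk u f v ∈ distTriang _)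
    (hf : ∀ s, Mono ((homologyFunctor C s).map f)) :
    ∃ (W : DerivedCategory C) (a : Y ⟶ W) (b : W ⟶ X) (c : X ⟶ Y⟦(1 : ℤ)⟧) (a' : P ⟶ W)
      (b' : W ⟶ Z⟦(1 : ℤ)⟧) (c' : Z⟦(1 : ℤ)⟧ ⟶ P⟦(1 : ℤ)⟧),
      Triangle.mk a b c ∈ cohExact C ∧ Triangle.mk a' b' c' ∈ cohExact C := by
  obtain ⟨W, a', b', hW⟩ := distinguished_cocone_triangle (u ≫ i)
  let O := Triangulated.someOctahedron rfl hu hi.1 hW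
  refine ⟨W, O.m₁, O.m₃, _, a', b', _, ⟨O.mem, fun s => ?_⟩,
    mem_cohExact_of_mono (rot_of_distTriang _ hW) fun s => ?_⟩
  · have epi_comp : Epi ((homologyFunctor C s).map a' ≫ (homologyFunctor C s).map O.m₃) := by
      rw [← Functor.map_comp, O.comm₃]
      exact hi.2 s
    change Epi ((homologyFunctor C s).map O.m₃)
    exact epi_of_epi ((homologyFunctor C s).map a') _
  · have map_u : (homologyFunctor C s).map u = 0 :=
      (HomologySequence.mono_homologyMap_mor₂_iff _ hu s).1 (hf s)
    refine (HomologySequence.mono_homologyMap_mor₂_iff _ hW s).2 ?_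
    exact ((homologyFunctor C s).map_comp u i).trans ((congrArg (· ≫ _) map_u).trans zero_comp)

section

variable [EnoughInjectives C] [HasExt.{u} C] {A B : ObjectProperty C}
  (h : AbelianCotorsion.IsCompleteHereditary A B)

include h

theorem exists_isSpecialPreenvelope_homologyFunctor_map (X : DerivedCategory C) :
    ∃ (Y : DerivedCategory C) (f : X ⟶ Y),
      ∀ s, AbelianCotorsion.IsSpecialPreenvelope A B ((homologyFunctor C s).map f) := by
  have := h.isClosedUnderIsomorphisms_left
  have := h.isClosedUnderIsomorphisms_right
  let e := Q.objObjPreimageIso X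
  obtain ⟨L, f, hf⟩ := h.exists_isSpecialPreenvelope_homologyMap (Q.objPreimage X)
  refine ⟨Q.obj L, e.inv ≫ Q.map f, fun s => (hf s).of_arrow_iso
    ((homologyQIso _ s).symm ≪≫ (homologyFunctor C s).mapIso e) (homologyQIso L s).symm ?_⟩
  simp only [Iso.symm_hom, Iso.trans_hom, Functor.mapIso_hom, Category.assoc]
  rw [← Functor.map_comp, e.hom_inv_id_assoc, Iso.comp_inv_eq, Category.assoc,
    homologyQIso_hom_naturality, Iso.inv_hom_id_assoc]

theorem exists_preenvelope_triangle (X : DerivedCategory C) :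
    ∃ (Z Y : DerivedCategory C) (u : Z ⟶ X) (f : X ⟶ Y) (v : Y ⟶ Z⟦(1 : ℤ)⟧),
      Triangle.mk u f v ∈ distTriang _ ∧ (Triangle.mk u f v).rotate ∈ cohExact C ∧
        cohLift B Y ∧ cohLift A (Z⟦(1 : ℤ)⟧) := by
  have := h.isClosedUnderIsomorphisms_left
  obtain ⟨Y, f, hf⟩ := exists_isSpecialPreenvelope_homologyFunctor_map h X
  obtain ⟨Z, u, v, hu⟩ := distinguished_cocone_triangle₁ f
  have rotate_mem : (Triangle.mk u f v).rotate ∈ cohExact C :=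
    mem_cohExact_of_mono (rot_of_distTriang _ hu) fun s => (hf s).mono
  refine ⟨Z, Y, u, f, v, hu, rotate_mem, fun s => (hf s).mem, fun s => ?_⟩
  have hs := shortExact_homology rotate_mem s
  have := hs.epi_g
  exact A.prop_of_iso (IsColimit.coconePointUniqueUpToIso (colimit.isColimit _) hs.gIsCokernel)
    (hf s).cokernel_mem

variable [EnoughProjectives C]

theorem exists_precover_triangle (X : DerivedCategory C) :
    ∃ (Y W : DerivedCategory C) (a : Y ⟶ W) (b : W ⟶ X) (c : X ⟶ Y⟦(1 : ℤ)⟧),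
      cohLift B Y ∧ cohLift A W ∧ Triangle.mk a b c ∈ cohExact C := by
  obtain ⟨K, P, i, p, δ, hP, hi⟩ := exists_formalProjective_cover X
  obtain ⟨Z, Y, u, f, v, hu, hf, hY, hZ⟩ := exists_preenvelope_triangle h K
  obtain ⟨W, a, b, c, a', b', c', hW, hW'⟩ := exists_cohExact_cobaseChange hi hu
    fun s => (shortExact_homology hf s).mono_f
  have := hP.projective
  exact ⟨Y, W, a, b, c, hY, fun s => h.extension_mem_left (shortExact_homology hW' s)
    (h.mem_left_of_projective ((homologyFunctor C s).obj P)) (hZ s), hW⟩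

theorem isCompleteHereditary_cohLift :
    IsCompleteHereditary (cohExact C) (cohLift A) (cohLift B) where
  right_eq := by
    have := h.isClosedUnderIsomorphisms_left
    have : A.ContainsZero := ⟨0, isZero_zero C, h.mem_left_of_projective 0⟩
    ext U
    refine ⟨fun hU s => ?_, fun hU X hX =>
      (xiExtOneVanishes_iff X U).2 fun s => h.subsingleton_ext (hX s) (hU s)⟩
    rw [← h.right_eq]
    exact fun M hM => (xiExtOneVanishes_single_left_iff M s U).1
      (hU _ ((cohLift_single_iff M s).2 hM))
  left_eq := by
    have := h.isClosedUnderIsomorphisms_right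
    have : B.ContainsZero := ⟨0, isZero_zero C, h.mem_right_of_injective 0⟩
    ext V
    refine ⟨fun hV s => ?_, fun hV Y hY =>
      (xiExtOneVanishes_iff V Y).2 fun s => h.subsingleton_ext (hV s) (hY s)⟩
    rw [← h.left_eq]
    exact fun M hM => (xiExtOneVanishes_single_right_iff V M s).1
      (hV _ ((cohLift_single_iff M s).2 hM))
  exists_precover := exists_precover_triangle h
  exists_preenvelope X := by
    obtain ⟨Z, Y, u, f, v, -, hf, hY, hZ⟩ := exists_preenvelope_triangle h X
    exact ⟨Y, _, f, v, _, hY, hZ, hf⟩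
  left_mem _ hΔ h₂ h₃ s := h.kernel_mem _ (shortExact_homology hΔ s) (h₂ s) (h₃ s)
  right_mem _ hΔ h₁ h₂ s := h.cokernel_mem _ (shortExact_homology hΔ s) (h₁ s) (h₂ s)

end

section

variable [EnoughProjectives C] [HasExt.{u} C]

theorem isCompleteHereditary_of_cohLift {A B : ObjectProperty C}
    [A.IsClosedUnderIsomorphisms] [A.ContainsZero] [B.IsClosedUnderIsomorphisms] [B.ContainsZero]
    (h : IsCompleteHereditary (cohExact C) (cohLift A) (cohLift B)) :
    AbelianCotorsion.IsCompleteHereditary A B where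
  right_eq := by
    ext M
    rw [← cohLift_single_iff (S := B) M 0, ← h.right_eq]
    refine ⟨fun hM X hX => (xiExtOneVanishes_single_right_iff X M 0).2 (hM _ (hX 0)),
      fun hM N hN => ?_⟩
    have := (xiExtOneVanishes_single_right_iff _ M 0).1 (hM _ ((cohLift_single_iff N 0).2 hN))
    exact AbelianCotorsion.subsingleton_ext_of_iso (homologySingleIso N 0) (Iso.refl M)
  left_eq := by
    ext M
    rw [← cohLift_single_iff (S := A) M 0, ← h.left_eq]
    refine ⟨fun hM X hX => (xiExtOneVanishes_single_left_iff M 0 X).2 (hM _ (hX 0)),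
      fun hM N hN => ?_⟩
    have := (xiExtOneVanishes_single_left_iff M 0 _).1 (hM _ ((cohLift_single_iff N 0).2 hN))
    exact AbelianCotorsion.subsingleton_ext_of_iso (Iso.refl M) (homologySingleIso N 0)
  exists_precover M := by
    obtain ⟨Y, X, f, g, k, hY, hX, hΔ⟩ := h.exists_precover ((singleFunctor C 0).obj M)
    obtain ⟨w, hw⟩ := exists_shortExact_homology hΔ 0
    refine ⟨_, _, (homologyFunctor C 0).map f,
      (homologyFunctor C 0).map g ≫ (homologySingleIso M 0).hom,
      by rw [reassoc_of% w, zero_comp], hY 0, hX 0, ?_⟩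
    refine ShortComplex.shortExact_of_iso ?_ hw
    exact ShortComplex.isoMk (Iso.refl _) (Iso.refl _) (homologySingleIso M 0)
  exists_preenvelope M := by
    obtain ⟨Y, X, f, g, k, hY, hX, hΔ⟩ := h.exists_preenvelope ((singleFunctor C 0).obj M)
    obtain ⟨w, hw⟩ := exists_shortExact_homology hΔ 0
    refine ⟨_, _, (homologySingleIso M 0).inv ≫ (homologyFunctor C 0).map f,
      (homologyFunctor C 0).map g, by rw [Category.assoc, w, comp_zero], hY 0, hX 0, ?_⟩
    refine ShortComplex.shortExact_of_iso ?_ hw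
    exact ShortComplex.isoMk (homologySingleIso M 0) (Iso.refl _) (Iso.refl _)
  kernel_mem S hS h₂ h₃ := by
    simp only [← cohLift_single_iff (S := A) _ 0] at h₂ h₃ ⊢
    exact h.left_mem _ (singleTriangle_mem_cohExact hS) h₂ h₃
  cokernel_mem S hS h₁ h₂ := by
    simp only [← cohLift_single_iff (S := B) _ 0] at h₁ h₂ ⊢
    exact h.right_mem _ (singleTriangle_mem_cohExact hS) h₁ h₂

variable {𝒜 ℬ : ObjectProperty (DerivedCategory C)}
  (h : IsCompleteHereditary (cohExact C) 𝒜 ℬ)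

include h

theorem left_mem_iff_single (X : DerivedCategory C) :
    𝒜 X ↔ ∀ s, 𝒜 ((singleFunctor C s).obj ((homologyFunctor C s).obj X)) := by
  simp only [← h.left_eq, leftPerp, xiExtOneVanishes_single_left_iff, xiExtOneVanishes_iff X]
  exact ⟨fun h s Y hY => h Y hY s, fun h Y hY s => h s Y hY⟩

theorem right_mem_iff_single (Y : DerivedCategory C) :
    ℬ Y ↔ ∀ s, ℬ ((singleFunctor C s).obj ((homologyFunctor C s).obj Y)) := by
  simp only [← h.right_eq, rightPerp, xiExtOneVanishes_single_right_iff, xiExtOneVanishes_iff _ Y]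
  exact ⟨fun h s X hX => h X hX s, fun h X hX s => h s X hX⟩

theorem left_single_mem_of_iso {M N : C} (e : M ≅ N) {s : ℤ} (hM : 𝒜 ((singleFunctor C s).obj M)) :
    𝒜 ((singleFunctor C s).obj N) := by
  simp only [← h.left_eq, leftPerp, xiExtOneVanishes_single_left_iff] at hM ⊢
  intro Y hY
  have := hM Y hY
  exact AbelianCotorsion.subsingleton_ext_of_iso e (Iso.refl _)

theorem right_single_mem_of_iso {M N : C} (e : M ≅ N) {s : ℤ}
    (hM : ℬ ((singleFunctor C s).obj M)) : ℬ ((singleFunctor C s).obj N) := by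
  simp only [← h.right_eq, rightPerp, xiExtOneVanishes_single_right_iff] at hM ⊢
  intro X hX
  have := hM X hX
  exact AbelianCotorsion.subsingleton_ext_of_iso (Iso.refl _) e

theorem left_single_mem_of_projective (M : C) [Projective M] (s : ℤ) :
    𝒜 ((singleFunctor C s).obj M) := by
  rw [← h.left_eq]
  exact fun Y _ => (xiExtOneVanishes_single_left_iff M s Y).2
    (Abelian.Ext.subsingleton_of_projective _ _ 0)

theorem right_single_mem_of_injective (M : C) [Injective M] (s : ℤ) :
    ℬ ((singleFunctor C s).obj M) := by
  rw [← h.right_eq]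
  exact fun X _ => (xiExtOneVanishes_single_right_iff X M s).2
    (Abelian.Ext.subsingleton_of_injective _ _ 0)

end

end RelTriangulated

/-! ### Resolutions of objects with a single cohomology object -/

namespace RelTriangulated

open DerivedCategory ZeroObject

variable {C : Type*} [Category* C] [Abelian C]

def opcyclesIsoCokernel (K : CochainComplex C ℤ) {i j : ℤ} (h : i + 1 = j) :
    K.opcycles j ≅ cokernel (K.d i j) :=
  IsColimit.coconePointUniqueUpToIso (K.opcyclesIsCokernel i j ((ComplexShape.up ℤ).prev_eq' h))
    (colimit.isColimit _)

def cyclesIsoKernel (K : CochainComplex C ℤ) {i j : ℤ} (h : i + 1 = j) :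
    K.cycles i ≅ kernel (K.d i j) :=
  IsLimit.conePointUniqueUpToIso (K.cyclesIsKernel i j ((ComplexShape.up ℤ).next_eq' h))
    (limit.isLimit _)

section Retract

variable [HasDerivedCategory.{w} C]

theorem exists_Q_map_eq_of_isKProjective {P L : CochainComplex C ℤ} (hP : P.IsKProjective)
    (φ : Q.obj P ⟶ Q.obj L) : ∃ f : P ⟶ L, Q.map f = φ := by
  obtain ⟨g, hg⟩ := (CochainComplex.IsKProjective.Qh_map_bijective P
    ((HomotopyCategory.quotient C _).obj L)).2
      ((quotientCompQhIso C).hom.app P ≫ φ ≫ (quotientCompQhIso C).inv.app L)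
  obtain ⟨f, rfl⟩ := (HomotopyCategory.quotient C _).map_surjective g
  refine ⟨f, ?_⟩
  rw [← cancel_epi ((quotientCompQhIso C).hom.app P),
    ← cancel_mono ((quotientCompQhIso C).inv.app L), Category.assoc _ φ, ← hg,
    ← (quotientCompQhIso C).hom.naturality, Category.assoc, Iso.hom_inv_id_app, Category.comp_id]
  rfl

theorem exists_Q_map_eq_of_isKInjective {K I : CochainComplex C ℤ} (hI : I.IsKInjective)
    (φ : Q.obj K ⟶ Q.obj I) : ∃ f : K ⟶ I, Q.map f = φ := by
  obtain ⟨g, hg⟩ := (CochainComplex.IsKInjective.Qh_map_bijective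
    ((HomotopyCategory.quotient C _).obj K) I).2
      ((quotientCompQhIso C).hom.app K ≫ φ ≫ (quotientCompQhIso C).inv.app I)
  obtain ⟨f, rfl⟩ := (HomotopyCategory.quotient C _).map_surjective g
  refine ⟨f, ?_⟩
  rw [← cancel_epi ((quotientCompQhIso C).hom.app K),
    ← cancel_mono ((quotientCompQhIso C).inv.app I), Category.assoc _ φ, ← hg,
    ← (quotientCompQhIso C).hom.naturality, Category.assoc, Iso.hom_inv_id_app, Category.comp_id]
  rfl

theorem nonempty_retract_opcycles_of_iso_single {P : CochainComplex C ℤ} (hP : P.IsKProjective)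
    {M : C} {s : ℤ} (e : Q.obj P ≅ (singleFunctor C s).obj M) :
    Nonempty (Retract M (P.opcycles s)) := by
  let L : CochainComplex C ℤ := (HomologicalComplex.single _ _ s).obj M
  have isIso_homologyι : IsIso (L.homologyι s) := L.isIso_homologyι s (s + 1) (by simp)
    (HomologicalComplex.single_obj_d ..)
  obtain ⟨f, hf⟩ := exists_Q_map_eq_of_isKProjective hP (L := L) e.hom
  have : QuasiIso f := by
    rw [← isIso_Q_map_iff_quasiIso, hf]
    exact inferInstanceAs (IsIso e.hom)
  have : IsIso (P.homologyι s ≫ HomologicalComplex.opcyclesMap f s) := by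
    rw [← HomologicalComplex.homologyι_naturality]
    infer_instance
  let r : Retract (P.homology s) (P.opcycles s) :=
    { i := P.homologyι s
      r := HomologicalComplex.opcyclesMap f s ≫
        inv (P.homologyι s ≫ HomologicalComplex.opcyclesMap f s)
      retract := by rw [← Category.assoc, IsIso.hom_inv_id] }
  let e' : M ≅ P.homology s := (homologySingleIso M s).symm ≪≫
    (homologyFunctor C s).mapIso e.symm ≪≫ homologyQIso P s
  exact ⟨(Retract.ofIso e').trans r⟩

theorem nonempty_retract_cycles_of_single_iso {I : CochainComplex C ℤ} (hI : I.IsKInjective)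
    {M : C} {s : ℤ} (e : (singleFunctor C s).obj M ≅ Q.obj I) :
    Nonempty (Retract M (I.cycles s)) := by
  let L : CochainComplex C ℤ := (HomologicalComplex.single _ _ s).obj M
  have isIso_homologyπ : IsIso (L.homologyπ s) := L.isIso_homologyπ (s - 1) s (by simp)
    (HomologicalComplex.single_obj_d ..)
  obtain ⟨f, hf⟩ := exists_Q_map_eq_of_isKInjective hI (K := L) e.hom
  have : QuasiIso f := by
    rw [← isIso_Q_map_iff_quasiIso, hf]
    exact inferInstanceAs (IsIso e.hom)
  have : IsIso (HomologicalComplex.cyclesMap f s ≫ I.homologyπ s) := by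
    rw [← HomologicalComplex.homologyπ_naturality]
    infer_instance
  let r : Retract (I.homology s) (I.cycles s) :=
    { i := inv (HomologicalComplex.cyclesMap f s ≫ I.homologyπ s) ≫
        HomologicalComplex.cyclesMap f s
      r := I.homologyπ s
      retract := by rw [Category.assoc, IsIso.inv_hom_id] }
  let e' : M ≅ I.homology s := (homologySingleIso M s).symm ≪≫
    (homologyFunctor C s).mapIso e ≪≫ homologyQIso I s
  exact ⟨(Retract.ofIso e').trans r⟩

end Retract

section Double

theorem exists_projective_presentation [EnoughProjectives C] (M : C) :
    ∃ (P₁ P₀ : C) (f : P₁ ⟶ P₀), Projective P₁ ∧ Projective P₀ ∧ Nonempty (cokernel f ≅ M) :=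
  ⟨_, _, Projective.π (kernel (Projective.π M)) ≫ kernel.ι (Projective.π M), inferInstance,
    inferInstance, ⟨cokernelEpiComp _ _ ≪≫ IsColimit.coconePointUniqueUpToIso (cokernelIsCokernel _)
      (ShortComplex.exact_kernel (Projective.π M)).gIsCokernel⟩⟩

theorem exists_injective_copresentation [EnoughInjectives C] (M : C) :
    ∃ (I₀ I₁ : C) (f : I₀ ⟶ I₁), Injective I₀ ∧ Injective I₁ ∧ Nonempty (kernel f ≅ M) :=
  ⟨_, _, cokernel.π (Injective.ι M) ≫ Injective.ι (cokernel (Injective.ι M)), inferInstance,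
    inferInstance, ⟨kernelCompMono _ _ ≪≫ IsLimit.conePointUniqueUpToIso (kernelIsKernel _)
      (ShortComplex.exact_cokernel (Injective.ι M)).fIsKernel⟩⟩

variable {X₀ X₁ : C} (f : X₀ ⟶ X₁) (s : ℤ)

/-- The cochain complex consisting of `f` placed in degrees `s` and `s + 1`. -/
abbrev twoTerm : CochainComplex C ℤ :=
  HomologicalComplex.double f (c := .up ℤ) (i₀ := s) (i₁ := s + 1) rfl

theorem twoTerm_X_mem {S : ObjectProperty C} [S.IsClosedUnderIsomorphisms] [S.ContainsZero]
    (h₀ : S X₀) (h₁ : S X₁) (i : ℤ) : S ((twoTerm f s).X i) := by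
  by_cases hi₀ : i = s
  · subst hi₀
    exact S.prop_of_iso (HomologicalComplex.doubleXIso₀ f _).symm h₀
  by_cases hi₁ : i = s + 1
  · subst hi₁
    exact S.prop_of_iso (HomologicalComplex.doubleXIso₁ f _ (by simp)).symm h₁
  · exact S.prop_of_isZero (HomologicalComplex.isZero_double_X f _ i hi₀ hi₁)

theorem projective_twoTerm_X [Projective X₀] [Projective X₁] (i : ℤ) :
    Projective ((twoTerm f s).X i) := by
  have : (isProjective C).IsClosedUnderIsomorphisms := ⟨fun e h => @Projective.of_iso _ _ _ _ e h⟩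
  have : (isProjective C).ContainsZero := ⟨0, isZero_zero C, inferInstance⟩
  exact twoTerm_X_mem (S := isProjective C) f s ‹_› ‹_› i

theorem injective_twoTerm_X [Injective X₀] [Injective X₁] (i : ℤ) :
    Injective ((twoTerm f s).X i) := by
  have : (isInjective C).IsClosedUnderIsomorphisms := ⟨fun e h => @Injective.of_iso _ _ _ _ e h⟩
  exact twoTerm_X_mem (S := isInjective C) f s ‹_› ‹_› i

instance : (twoTerm f s).IsStrictlyLE (s + 1) := by
  rw [CochainComplex.isStrictlyLE_iff]
  exact fun i hi => HomologicalComplex.isZero_double_X f _ i (by lia) (by lia)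

instance : (twoTerm f s).IsStrictlyGE s := by
  rw [CochainComplex.isStrictlyGE_iff]
  exact fun i hi => HomologicalComplex.isZero_double_X f _ i (by lia) (by lia)

def cokernelTwoTermIso : cokernel ((twoTerm f s).d s (s + 1)) ≅ cokernel f :=
  cokernelIsoOfEq (HomologicalComplex.double_d f _ (by simp)) ≪≫ cokernelEpiComp _ _ ≪≫
    cokernelCompIsIso _ _

def kernelTwoTermIso : kernel ((twoTerm f s).d s (s + 1)) ≅ kernel f :=
  kernelIsoOfEq (HomologicalComplex.double_d f _ (by simp)) ≪≫ kernelIsIsoComp _ _ ≪≫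
    kernelCompMono _ _

theorem nonempty_homology_twoTerm_iso_cokernel :
    Nonempty ((twoTerm f s).homology (s + 1) ≅ cokernel f) := by
  have := (twoTerm f s).isIso_homologyι (s + 1) (s + 1 + 1) (by simp)
    (HomologicalComplex.double_d_eq_zero₀ f _ _ _ (by simp))
  exact ⟨asIso ((twoTerm f s).homologyι (s + 1)) ≪≫ opcyclesIsoCokernel _ rfl ≪≫
    cokernelTwoTermIso f s⟩

theorem nonempty_homology_twoTerm_iso_kernel :
    Nonempty ((twoTerm f s).homology s ≅ kernel f) := by
  have := (twoTerm f s).isIso_homologyπ (s - 1) s (by simp)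
    (HomologicalComplex.double_d_eq_zero₁ f _ _ _ (by simp))
  exact ⟨(asIso ((twoTerm f s).homologyπ s)).symm ≪≫ cyclesIsoKernel _ rfl ≪≫
    kernelTwoTermIso f s⟩

variable {f} {S : ObjectProperty C} [S.IsClosedUnderIsomorphisms] [S.ContainsZero]

theorem cokernel_twoTerm_d_mem (h₀ : S X₀) (h₁ : S X₁) (hf : S (cokernel f)) {i j : ℤ}
    (hij : i + 1 = j) : S (cokernel ((twoTerm f s).d i j)) := by
  by_cases hi : i = s
  · subst hi hij
    exact S.prop_of_iso (cokernelTwoTermIso f i).symm hf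
  · exact S.prop_of_iso (cokernelZeroIsoTarget.symm ≪≫ cokernelIsoOfEq
      (HomologicalComplex.double_d_eq_zero₀ f _ i j hi).symm) (twoTerm_X_mem f s h₀ h₁ j)

theorem kernel_twoTerm_d_mem (h₀ : S X₀) (h₁ : S X₁) (hf : S (kernel f)) (i : ℤ) :
    S (kernel ((twoTerm f s).d i (i + 1))) := by
  by_cases hi : i = s
  · subst hi
    exact S.prop_of_iso (kernelTwoTermIso f i).symm hf
  · exact S.prop_of_iso (kernelZeroIsoSource.symm ≪≫ kernelIsoOfEq
      (HomologicalComplex.double_d_eq_zero₀ f _ i (i + 1) hi).symm) (twoTerm_X_mem f s h₀ h₁ i)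

end Double

end RelTriangulated

/-! ### Cotorsion pairs in the derived category of modules -/

namespace DerivedMod

open DerivedCategory RelTriangulated

variable {R : Type u} [Ring R]

theorem isSemiProjective_twoTerm {P₁ P₀ : ModuleCat.{u} R} [Projective P₁] [Projective P₀]
    (f : P₁ ⟶ P₀) (s : ℤ) : IsSemiProjective (twoTerm f s) :=
  have := projective_twoTerm_X f s
  ⟨this, CochainComplex.isKProjective_of_projective _ (s + 1)⟩

theorem isSemiInjective_twoTerm {I₀ I₁ : ModuleCat.{u} R} [Injective I₀] [Injective I₁]
    (f : I₀ ⟶ I₁) (s : ℤ) : IsSemiInjective (twoTerm f s) :=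
  have := injective_twoTerm_X f s
  ⟨this, CochainComplex.isKInjective_of_injective _ s⟩

variable [HasDerivedCategory.{w} (ModuleCat.{u} R)]

theorem angleOne_shift_single {S : ObjectProperty (ModuleCat.{u} R)} {M : ModuleCat.{u} R}
    (hM : S M) (n : ℤ) : angleOne S (((singleFunctor (ModuleCat.{u} R) 0).obj M)⟦n⟧) :=
  ⟨PUnit, fun _ => M, fun _ => n, Cofan.mk _ fun _ => 𝟙 _, fun _ => hM,
    ⟨Cofan.IsColimit.mk _ (fun t => t.inj PUnit.unit) (fun _ _ => by simp)
      (fun t m hm => by simpa using hm PUnit.unit)⟩, ⟨Retract.refl _⟩⟩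

def shiftSingleIso (M : ModuleCat.{u} R) (s : ℤ) :
    ((singleFunctor (ModuleCat.{u} R) 0).obj M)⟦-s⟧ ≅ (singleFunctor (ModuleCat.{u} R) s).obj M :=
  ((singleFunctors (ModuleCat.{u} R)).shiftIso (-s) s 0 (by simp)).app M

theorem isFormalProjective_shift_single (M : ModuleCat.{u} R) [Projective M] (s : ℤ) :
    IsFormalProjective (((singleFunctor (ModuleCat.{u} R) 0).obj M)⟦-s⟧) :=
  (isFormalProjective_singleFunctor_obj M s).of_retract (Retract.ofIso (shiftSingleIso M s))

theorem xi_subset_cohExact : xi R ⊆ cohExact (ModuleCat.{u} R) := by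
  rintro Δ ⟨hΔ, h⟩
  refine ⟨hΔ, fun s => ?_⟩
  let M := Projective.over ((homologyFunctor _ s).obj Δ.obj₃)
  let e := (homologyFunctor _ s).mapIso (shiftSingleIso M s) ≪≫ homologySingleIso M s
  obtain ⟨g, hg, -⟩ := (isFormalProjective_shift_single M s).exists_map_degree s
    (e.hom ≫ Projective.π ((homologyFunctor _ s).obj Δ.obj₃))
  obtain ⟨f, rfl⟩ := ((homShortExact_iff hΔ _).1
    (h _ (angleOne_shift_single (S := fun M => Projective M) inferInstance _))).2 g
  rw [Functor.map_comp] at hg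
  have : Epi ((homologyFunctor _ s).map f ≫ (homologyFunctor _ s).map Δ.mor₂) := by
    rw [hg]
    infer_instance
  exact epi_of_epi ((homologyFunctor _ s).map f) _

theorem cohExact_subset_xi : cohExact (ModuleCat.{u} R) ⊆ xi R := by
  rintro Δ hΔ
  refine ⟨hΔ.1, ?_⟩
  rintro P ⟨ι, M, n, c, hM, ⟨hc⟩, ⟨r⟩⟩
  refine HomShortExact.of_retract hΔ.1 (HomShortExact.of_isColimit hΔ.1 hc fun j => ?_) r
  have : Projective (M j) := hM j
  obtain ⟨s, hs⟩ := neg_surjective (n j)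
  rw [← hs]
  exact (isFormalProjective_shift_single (M j) s).isProjective Δ hΔ

theorem xi_eq_cohExact : xi R = cohExact (ModuleCat.{u} R) :=
  xi_subset_cohExact.antisymm cohExact_subset_xi

section Module

variable {A B : ObjectProperty (ModuleCat.{u} R)} (h : AbelianCotorsion.IsCompleteHereditary A B)

include h

theorem projLift_eq_cohLift : projLift A = cohLift A := by
  have := h.isClosedUnderIsomorphisms_left
  ext X
  constructor
  · rintro ⟨P, hP, ⟨e⟩, hA⟩ s
    have := hP.projective
    exact A.prop_of_iso ((homologyQIso P s).symm ≪≫ (homologyFunctor _ s).mapIso e)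
      (h.homology_mem_of_opcycles_mem
        (fun s => A.prop_of_iso (opcyclesIsoCokernel P (by simp)).symm (hA s)) s)
  · intro hX
    obtain ⟨P, f, P_projective, P_isKProjective, hf⟩ :=
      exists_semiProjective_resolution (Q.objPreimage X)
    have := (isIso_Q_map_iff_quasiIso _ f).2 hf
    let e : Q.obj P ≅ X := asIso (Q.map f) ≪≫ Q.objObjPreimageIso X
    refine ⟨P, ⟨P_projective, P_isKProjective⟩, ⟨e⟩, fun s =>
      A.prop_of_iso (opcyclesIsoCokernel P (by simp))
        (h.opcycles_mem_of_isKProjective P_isKProjective P_projective (fun s => ?_) s)⟩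
    exact A.prop_of_iso ((homologyFunctor _ s).mapIso e.symm ≪≫ homologyQIso P s) (hX s)

theorem injLift_eq_cohLift : injLift B = cohLift B := by
  have := h.isClosedUnderIsomorphisms_right
  have : HasExt.{u} (ModuleCat.{u} R)ᵒᵖ := hasExt_of_enoughProjectives _
  ext X
  constructor
  · rintro ⟨I, hI, ⟨e⟩, hB⟩ s
    have := hI.injective
    exact B.prop_of_iso ((homologyQIso I s).symm ≪≫ (homologyFunctor _ s).mapIso e.symm)
      (h.homology_mem_of_cycles_mem
        (fun s => B.prop_of_iso (cyclesIsoKernel I rfl).symm (hB s)) s)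
  · intro hX
    obtain ⟨I, f, I_injective, I_isKInjective, hf⟩ :=
      exists_semiInjective_resolution (Q.objPreimage X)
    have := (isIso_Q_map_iff_quasiIso _ f).2 hf
    let e : X ≅ Q.obj I := (Q.objObjPreimageIso X).symm ≪≫ asIso (Q.map f)
    refine ⟨I, ⟨I_injective, I_isKInjective⟩, ⟨e⟩, fun s =>
      B.prop_of_iso (cyclesIsoKernel I rfl)
        (h.cycles_mem_of_isKInjective I_isKInjective I_injective (fun s => ?_) s)⟩
    exact B.prop_of_iso ((homologyFunctor _ s).mapIso e ≪≫ homologyQIso I s) (hX s)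

end Module

variable {A B : ObjectProperty (ModuleCat.{u} R)}
  {𝒜 ℬ : ObjectProperty (DerivedCategory (ModuleCat.{u} R))}

theorem mem_of_projLift_single [A.IsStableUnderRetracts] {M : ModuleCat.{u} R} {s : ℤ}
    (h : projLift A ((singleFunctor (ModuleCat.{u} R) s).obj M)) : A M := by
  obtain ⟨P, hP, ⟨e⟩, hA⟩ := h
  obtain ⟨r⟩ := nonempty_retract_opcycles_of_iso_single hP.isKProjective e
  exact A.prop_of_retract r (A.prop_of_iso (opcyclesIsoCokernel P (by simp)).symm (hA s))

theorem mem_of_injLift_single [B.IsStableUnderRetracts] {M : ModuleCat.{u} R} {s : ℤ}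
    (h : injLift B ((singleFunctor (ModuleCat.{u} R) s).obj M)) : B M := by
  obtain ⟨I, hI, ⟨e⟩, hB⟩ := h
  obtain ⟨r⟩ := nonempty_retract_cycles_of_single_iso hI.isKInjective e
  exact B.prop_of_retract r (B.prop_of_iso (cyclesIsoKernel I rfl).symm (hB s))

theorem exists_projLift_homology_iso [A.IsClosedUnderIsomorphisms]
    (hA : ∀ M : ModuleCat.{u} R, Projective M → A M) {M : ModuleCat.{u} R} (hM : A M) (s : ℤ) :
    ∃ X, projLift A X ∧ Nonempty ((homologyFunctor _ s).obj X ≅ M) := by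
  obtain ⟨r, rfl⟩ : ∃ r, s = r + 1 := ⟨s - 1, by simp⟩
  obtain ⟨P₁, P₀, f, _, _, ⟨e⟩⟩ := exists_projective_presentation M
  have : A.ContainsZero := ⟨_, isZero_zero (ModuleCat.{u} R), hA _ inferInstance⟩
  obtain ⟨e'⟩ := nonempty_homology_twoTerm_iso_cokernel f r
  exact ⟨Q.obj (twoTerm f r), ⟨twoTerm f r, isSemiProjective_twoTerm f r, ⟨Iso.refl _⟩, fun s =>
    cokernel_twoTerm_d_mem r (hA P₁ ‹_›) (hA P₀ ‹_›) (A.prop_of_iso e.symm hM) (by simp)⟩,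
    ⟨homologyQIso _ (r + 1) ≪≫ e' ≪≫ e⟩⟩

theorem exists_injLift_homology_iso [B.IsClosedUnderIsomorphisms]
    (hB : ∀ M : ModuleCat.{u} R, Injective M → B M) {M : ModuleCat.{u} R} (hM : B M) (s : ℤ) :
    ∃ X, injLift B X ∧ Nonempty ((homologyFunctor _ s).obj X ≅ M) := by
  obtain ⟨I₀, I₁, f, _, _, ⟨e⟩⟩ := exists_injective_copresentation M
  have : B.ContainsZero := ⟨_, isZero_zero (ModuleCat.{u} R), hB _ inferInstance⟩
  obtain ⟨e'⟩ := nonempty_homology_twoTerm_iso_kernel f s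
  exact ⟨Q.obj (twoTerm f s), ⟨twoTerm f s, isSemiInjective_twoTerm f s, ⟨Iso.refl _⟩,
    kernel_twoTerm_d_mem s (hB I₀ ‹_›) (hB I₁ ‹_›) (B.prop_of_iso e.symm hM)⟩,
    ⟨homologyQIso _ s ≪≫ e' ≪≫ e⟩⟩

theorem mem_of_projective [A.IsStableUnderRetracts]
    (h : IsCompleteHereditary (cohExact _) (projLift A) ℬ) (M : ModuleCat.{u} R)
    [Projective M] : A M :=
  mem_of_projLift_single (left_single_mem_of_projective h M 0)

theorem mem_of_injective [B.IsStableUnderRetracts]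
    (h : IsCompleteHereditary (cohExact _) 𝒜 (injLift B)) (M : ModuleCat.{u} R)
    [Injective M] : B M :=
  mem_of_injLift_single (right_single_mem_of_injective h M 0)

theorem projLift_eq_cohLift_of_isCompleteHereditary [A.IsStableUnderRetracts]
    (h : IsCompleteHereditary (cohExact _) (projLift A) ℬ) : projLift A = cohLift A := by
  ext X
  rw [left_mem_iff_single h]
  refine forall_congr' fun s => ⟨mem_of_projLift_single, fun hX => ?_⟩
  obtain ⟨Y, hY, ⟨e⟩⟩ := exists_projLift_homology_iso (fun M _ => mem_of_projective h M) hX s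
  exact left_single_mem_of_iso h e ((left_mem_iff_single h Y).1 hY s)

theorem injLift_eq_cohLift_of_isCompleteHereditary [B.IsStableUnderRetracts]
    (h : IsCompleteHereditary (cohExact _) 𝒜 (injLift B)) : injLift B = cohLift B := by
  ext Y
  rw [right_mem_iff_single h]
  refine forall_congr' fun s => ⟨mem_of_injLift_single, fun hY => ?_⟩
  obtain ⟨X, hX, ⟨e⟩⟩ := exists_injLift_homology_iso (fun M _ => mem_of_injective h M) hY s
  exact right_single_mem_of_iso h e ((right_mem_iff_single h X).1 hX s)

end DerivedMod

end

theorem mainTheorem4 {R : Type u} [Ring R] [HasDerivedCategory.{w} (ModuleCat.{u} R)]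
    (A B C : ObjectProperty (ModuleCat.{u} R))
    [A.IsStableUnderRetracts] [B.IsStableUnderRetracts] [C.IsStableUnderRetracts] :
    ((AbelianCotorsion.IsCompleteHereditary A C ∧ AbelianCotorsion.IsCompleteHereditary C B) ↔
      (RelTriangulated.IsCompleteHereditary (DerivedMod.xi R)
          (DerivedMod.projLift A) (DerivedMod.injLift C) ∧
        RelTriangulated.IsCompleteHereditary (DerivedMod.xi R)
          (DerivedMod.injLift C) (DerivedMod.injLift B))) ∧
    (AbelianCotorsion.IsCompleteHereditary A C ∧ AbelianCotorsion.IsCompleteHereditary C B →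
      DerivedMod.projLift C = DerivedMod.injLift C) := by
  rw [DerivedMod.xi_eq_cohExact]
  refine ⟨⟨fun ⟨h₁, h₂⟩ => ?_, fun ⟨h₁, h₂⟩ => ?_⟩, fun ⟨h₁, h₂⟩ => ?_⟩
  · rw [DerivedMod.projLift_eq_cohLift h₁, DerivedMod.injLift_eq_cohLift h₁,
      DerivedMod.injLift_eq_cohLift h₂]
    exact ⟨RelTriangulated.isCompleteHereditary_cohLift h₁,
      RelTriangulated.isCompleteHereditary_cohLift h₂⟩
  · have : A.ContainsZero := ⟨_, isZero_zero _, DerivedMod.mem_of_projective h₁ _⟩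
    have : B.ContainsZero := ⟨_, isZero_zero _, DerivedMod.mem_of_injective h₂ _⟩
    have : C.ContainsZero := ⟨_, isZero_zero _, DerivedMod.mem_of_injective h₁ _⟩
    have hA := DerivedMod.projLift_eq_cohLift_of_isCompleteHereditary h₁
    have hB := DerivedMod.injLift_eq_cohLift_of_isCompleteHereditary h₂
    have hC := DerivedMod.injLift_eq_cohLift_of_isCompleteHereditary h₁
    rw [hA, hC] at h₁
    rw [hC, hB] at h₂
    exact ⟨RelTriangulated.isCompleteHereditary_of_cohLift h₁,
      RelTriangulated.isCompleteHereditary_of_cohLift h₂⟩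
  · exact (DerivedMod.projLift_eq_cohLift h₂).trans (DerivedMod.injLift_eq_cohLift h₁).symm
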